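/- Let $X=\mathbb R^p$, $U=\mathbb R^q$, let $\Omega_0\subseteq X$ and $M\subseteq\Omega_0\times U$ be open, and let $n\ge 1$. Write $U^{(n)}$ for the space with coordinates $u^\alpha_J$ ($1\le\alpha\le q$, $J$ an unordered multi-index of order at most $n$ with entries in $\{1,\dots,p\}$), $\mathrm{pr}^{(n)}f(x)=(\partial_Jf^\alpha(x))_{\alpha,J}$ for the $n$-jet of a smooth function $f$, and $M^{(n)}=\{(x,u^{(n)})\in X\times U^{(n)}:(x,u)\in M\}$. Let $L:M^{(n)}\to\mathbb R$ be smooth. Let $G$ be a connected local transformation group on $M$: a Lie group $G$, an open set $\mathcal U\subseteq G\times M$ containing $\{e\}\times M$ and a smooth map $\mathcal U\to M$, $(g,m)\mapsto g\cdot m$, such that $e\cdot m=m$; $g\cdot(h\cdot m)=(gh)\cdot m$ whenever $(h,m),(g,h\cdot m),(gh,m)\in\mathcal U$; $(g^{-1},g\cdot m)\in\mathcal U$ whenever $(g,m)\in\mathcal U$; and $M$, $G$, $\mathcal U$ and all sets $\mathcal U_m=\{g:(g,m)\in\mathcal U\}$ are connected. Write $g\cdot(x,u)=(\Xi_g(x,u),\Phi_g(x,u))$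 and $J_g=(D_j\Xi_g^i)_{i,j}$, where $D_jP=\partial_{x^j}P+\sum_\alpha u^\alpha_j\,\partial_{u^\alpha}P$. The infinitesimal generators of $G$ are the vector fields $v(m)=T_e(g\mapsto g\cdot m)(w)$ on $M$, $w\in T_eG$. For a smooth function $f$ on an open set $\Omega\subseteq X$ with graph $\Gamma_f\subseteq M$ and for $g\in G$, say that $g\cdot f$ is defined and equal to the smooth function $\tilde f$ on the open set $\tilde\Omega$ if $g\cdot\Gamma_f=\Gamma_{\tilde f}$ and if for every $x\in\Omega$ the element $g$ lies in the connected component of $e$ in $\{h\in\mathcal U_{(x,f(x))}:\det J_h(x,\mathrm{pr}^{(1)}f(x))\neq0\}$. Call $G$ a variational symmetry group of $\int_{\Omega_0}L(x,u^{(n)})\,dx$ if for every connected open $\Omega$ with $\overline\Omega\subseteq\Omega_0$, every smooth $f:\Omega\to U$ with graph in $M$ and every $g\in G$ such that $\tilde f=g\cdot f$ is defined, on $\tilde\Omega\subseteq\Omega_0$, $$\int_{\tilde\Omega}L(\tilde x,\mathrm{pr}^{(n)}\tilde f(\tilde x))\,d\tilde x=\int_\Omega L(x,\mathrm{pr}^{(n)}f(x))\,dx,$$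 where one integral exists if and only if the other one does. For a local diffeomorphism $\psi=(\Xi,\Phi)$ of $M$, put $\mathrm{pr}^{(n)}\psi\,(x,u^{(n)})=(\tilde x,\mathrm{pr}^{(n)}\tilde f(\tilde x))$, where $\tilde x=\Xi(x,u)$, $f$ is the Taylor polynomial with $\mathrm{pr}^{(n)}f(x)=u^{(n)}$, and $\tilde f$ is the smooth function near $\tilde x$ whose graph is the image under $\psi$ of the graph of $f$ near $x$. For a vector field $v$ on $M$ with flow $\mathrm{Fl}^v_\varepsilon$, put $\mathrm{pr}^{(n)}v|_z=\frac{d}{d\varepsilon}\big|_{0}\,\mathrm{pr}^{(n)}(\mathrm{Fl}^v_\varepsilon)(z)$ for $z\in M^{(n)}$. Then $G$ is a variational symmetry group of $\int_{\Omega_0}L(x,u^{(n)})\,dx$ if and only if $$\mathrm{pr}^{(n)}v(L)+L\cdot\mathrm{Div}\,\xi=0\quad\text{on }M^{(n)}$$ for every infinitesimal generator $v=\sum_i\xi^i(x,u)\,\partial_{x^i}+\sum_\alpha\phi_\alpha(x,u)\,\partial_{u^\alpha}$ of $G$, where $\mathrm{Div}\,\xi=\sum_iD_i\xi^i$. -/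

import Mathlib

open Set MeasureTheory Topology
open scoped Manifold ContDiff

noncomputable section

namespace VarSym

/-! ### Jets -/

/-- The space `X = ℝ^p` of independent variables. -/
abbrev IndepVar (p : ℕ) : Type := Fin p → ℝ

/-- The space `U = ℝ^q` of dependent variables. -/
abbrev DepVar (q : ℕ) : Type := Fin q → ℝ

/-- The total space `X × U`. -/
abbrev TotalSpace (p q : ℕ) : Type := IndepVar p × DepVar q

/-- Unordered multi-indices `J = (j₁, …, j_k)` with entries in `{1, …, p}` and `0 ≤ k ≤ n`. -/
abbrev MultiIndex (p n : ℕ) : Type := Σ k : Fin (n + 1), Sym (Fin p) k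

/-- The space `U^(n)`, with coordinates `u^α_J`. -/
abbrev DepJet (p q n : ℕ) : Type := MultiIndex p n → DepVar q

/-- The jet space `X × U^(n)`. -/
abbrev JetSpace (p q n : ℕ) : Type := IndepVar p × DepJet p q n

variable {p q n : ℕ}

/-- The zeroth order part `(x, u)` of a jet `(x, u^(n))`. -/
def JetSpace.base (z : JetSpace p q n) : TotalSpace p q := (z.1, z.2 ⟨0, Sym.nil⟩)

/-- The first order coordinates `u_i` of a jet of order at least one. -/
def JetSpace.first (hn : 1 ≤ n) (z : JetSpace p q n) (i : Fin p) : DepVar q :=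
  z.2 ⟨⟨1, Nat.lt_succ_of_le hn⟩, Sym.oneEquiv i⟩

/-- `M^(n) = M × U₁ × … × U_n`. -/
def jetSet (n : ℕ) (M : Set (TotalSpace p q)) : Set (JetSpace p q n) := {z | z.base ∈ M}

/-- The partial derivative `∂_J f (x)` for a list `J` of coordinate indices. -/
def partialDeriv (J : List (Fin p)) (f : IndepVar p → DepVar q) (x : IndepVar p) : DepVar q :=
  iteratedFDeriv ℝ J.length f x fun k => Pi.single (J.get k) 1

/-- The prolongation `pr^(n) f (x)`, with coordinates `u^α_J = ∂_J f^α (x)`. -/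
def prolongFun (n : ℕ) (f : IndepVar p → DepVar q) (x : IndepVar p) : DepJet p q n :=
  fun J => partialDeriv ((J.2 : Multiset (Fin p)).sort (· ≤ ·)) f x

/-- The Taylor polynomial `y ↦ ∑_J u_J / J! · (y - x)^J` with the jet `(x, u^(n))` at `x`. -/
def taylorFun (z : JetSpace p q n) (y : IndepVar p) : DepVar q :=
  ∑ J : MultiIndex p n,
    ((((J.2 : Multiset (Fin p)).map fun i => y i - z.1 i).prod) /
      ((∏ i : Fin p, ((J.2 : Multiset (Fin p)).count i).factorial : ℕ) : ℝ)) • z.2 J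

/-! ### Prolongation of transformations and of vector fields -/

/-- `f'` is, near `(ψ (x, f x)).1`, the smooth function onto whose graph the transformation `ψ`
maps the graph of `f` near `x`, that is, `f' = ψ · f` as germs. -/
def IsGermTransform (ψ : TotalSpace p q → TotalSpace p q) (f : IndepVar p → DepVar q)
    (x : IndepVar p) (f' : IndepVar p → DepVar q) : Prop :=
  ContDiffAt ℝ ∞ f' (ψ (x, f x)).1 ∧ ∀ᶠ y in 𝓝 x, f' (ψ (y, f y)).1 = (ψ (y, f y)).2

open Classical in
/-- The prolonged transformation
`pr^(n) ψ · (x, u^(n)) = (x', pr^(n) (ψ · f) (x'))`, `x' = (ψ (x, u)).1`, where `f` is the Taylor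
polynomial with jet `(x, u^(n))`; the fallback value is used only where `ψ · f` does not exist. -/
def prolongMap (n : ℕ) (ψ : TotalSpace p q → TotalSpace p q) (z : JetSpace p q n) :
    JetSpace p q n :=
  if h : ∃ f', IsGermTransform ψ (taylorFun z) z.1 f' then
    ((ψ z.base).1, prolongFun n h.choose (ψ z.base).1)
  else z

open Classical in
/-- The flow `Fl^v_ε (m)` on `M` of a vector field `v`: the value at time `ε` of the integral curve
in `M` that starts at `m`; the fallback value is used only where there is no such curve. -/
def flow (M : Set (TotalSpace p q)) (v : TotalSpace p q → TotalSpace p q) (ε : ℝ)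
    (m : TotalSpace p q) : TotalSpace p q :=
  if h : ∃ γ : ℝ → TotalSpace p q, γ 0 = m ∧ MapsTo γ (uIcc 0 ε) M ∧
      IsIntegralCurveOn γ (fun _ => v) (uIcc 0 ε) then
    h.choose ε
  else m

/-- The prolonged vector field `pr^(n) v |_z = d/dε|₀ pr^(n) (Fl^v_ε) (z)`. -/
def prolongField (n : ℕ) (M : Set (TotalSpace p q)) (v : TotalSpace p q → TotalSpace p q)
    (z : JetSpace p q n) : JetSpace p q n :=
  deriv (fun ε : ℝ => prolongMap n (flow M v ε) z) 0

/-- The total derivative `D_i P = ∂P/∂x^i + ∑_α u^α_i ∂P/∂u^α` of a function `P (x, u)`. -/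
def totalDeriv (hn : 1 ≤ n) (i : Fin p) (P : TotalSpace p q → ℝ) (z : JetSpace p q n) : ℝ :=
  fderiv ℝ P z.base (Pi.single i 1, z.first hn i)

/-- The total divergence `Div ξ = ∑_i D_i ξ^i` of a tuple of functions `ξ^i (x, u)`. -/
def totalDiv (hn : 1 ≤ n) (ξ : TotalSpace p q → IndepVar p) (z : JetSpace p q n) : ℝ :=
  ∑ i : Fin p, totalDeriv hn i (fun m => ξ m i) z

/-- The total Jacobian `J = (D_j Ξ^i)` of the `x`-component `Ξ` of a transformation `ψ`, at the
first order jet consisting of the point `m = (x, u)` and the first derivative `a` of `u`. -/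
def totalJacobian (ψ : TotalSpace p q → TotalSpace p q) (m : TotalSpace p q)
    (a : IndepVar p →L[ℝ] DepVar q) : IndepVar p →L[ℝ] IndepVar p :=
  (fderiv ℝ (fun m' => (ψ m').1) m).comp ((ContinuousLinearMap.id ℝ (IndepVar p)).prod a)

/-! ### Local transformation groups -/

/-- A local transformation group on `M ⊆ X × U`: a `d`-dimensional Lie group `G`, an open set
`domain ⊆ G × M` containing `{e} × M`, and a smooth map `(g, m) ↦ g · m` from it to `M`. The values
of `act` outside `domain` are irrelevant. -/
structure LocalTransformationGroup (d : ℕ) (G : Type*) [TopologicalSpace G]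
    [ChartedSpace (EuclideanSpace ℝ (Fin d)) G] [Group G] [LieGroup (𝓡 d) ∞ G]
    (M : Set (TotalSpace p q)) where
  domain : Set (G × TotalSpace p q)
  act : G → TotalSpace p q → TotalSpace p q
  isOpen_domain : IsOpen domain
  domain_subset : domain ⊆ univ ×ˢ M
  one_mem : ∀ m ∈ M, ((1 : G), m) ∈ domain
  act_mem : ∀ g m, (g, m) ∈ domain → act g m ∈ M
  smooth_act : ContMDiffOn ((𝓡 d).prod 𝓘(ℝ, TotalSpace p q)) 𝓘(ℝ, TotalSpace p q) ∞
    (fun y : G × TotalSpace p q => act y.1 y.2) domain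
  act_act : ∀ g h m, (h, m) ∈ domain → (g, act h m) ∈ domain → (g * h, m) ∈ domain →
    act g (act h m) = act (g * h) m
  one_act : ∀ m ∈ M, act 1 m = m
  inv_mem : ∀ g m, (g, m) ∈ domain → (g⁻¹, act g m) ∈ domain

namespace LocalTransformationGroup

variable {d : ℕ} {G : Type*} [TopologicalSpace G] [ChartedSpace (EuclideanSpace ℝ (Fin d)) G]
  [Group G] [LieGroup (𝓡 d) ∞ G] {M : Set (TotalSpace p q)}

/-- Connected local transformation groups: `M`, `G`, the domain, and all its sections
`{g | (g, m) ∈ domain}` are connected. -/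
def Connected (A : LocalTransformationGroup d G M) : Prop :=
  IsConnected M ∧ ConnectedSpace G ∧ IsConnected A.domain ∧
    ∀ m ∈ M, IsConnected {g : G | (g, m) ∈ A.domain}

/-- The infinitesimal generator `m ↦ T_e (g ↦ g · m) (w)` on `M` defined by `w ∈ T_e G`. -/
def generator (A : LocalTransformationGroup d G M) (w : GroupLieAlgebra (𝓡 d) G)
    (m : TotalSpace p q) : TotalSpace p q :=
  mfderiv (𝓡 d) 𝓘(ℝ, TotalSpace p q) (fun g : G => A.act g m) 1 w

/-- The set of all infinitesimal generators. -/
def generators (A : LocalTransformationGroup d G M) :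
    Set (TotalSpace p q → TotalSpace p q) :=
  range A.generator

/-- The group elements whose prolongation is defined at the first order jet `(m, a)`. Prolonging
`g` there requires that `g · m` is defined and that `J_g (m, a)` is invertible, and the prolonged
local transformation group, like every local transformation group, is taken to be connected: `g`
has to lie in the connected component of the identity. -/
def prolongedDomain (A : LocalTransformationGroup d G M) (m : TotalSpace p q)
    (a : IndepVar p →L[ℝ] DepVar q) : Set G :=
  connectedComponentIn
    {g : G | (g, m) ∈ A.domain ∧ (totalJacobian (A.act g) m a).det ≠ 0} 1

/-- `g · f` is well-defined and equal to the smooth function `f'` on the open set `Ω'`: the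
prolongation of `g` is defined along `f`, and `g` maps the graph of `f` over `Ω` onto the graph of
`f'` over `Ω'`. -/
def IsTransform (A : LocalTransformationGroup d G M) (g : G) (Ω : Set (IndepVar p))
    (f : IndepVar p → DepVar q) (Ω' : Set (IndepVar p)) (f' : IndepVar p → DepVar q) : Prop :=
  (∀ x ∈ Ω, g ∈ A.prolongedDomain (x, f x) (fderiv ℝ f x)) ∧
    IsOpen Ω' ∧ ContDiffOn ℝ ∞ f' Ω' ∧ A.act g '' (Ω.graphOn f) = Ω'.graphOn f'

/-- Variational symmetry groups of `∫_{Ω₀} L (x, u^(n)) dx`. That the two integrals agree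
includes that one of them exists if and only if the other one does. -/
def IsVariationalSymmetry (A : LocalTransformationGroup d G M) (Ω₀ : Set (IndepVar p))
    (L : JetSpace p q n → ℝ) : Prop :=
  ∀ (Ω : Set (IndepVar p)) (f : IndepVar p → DepVar q) (g : G)
    (Ω' : Set (IndepVar p)) (f' : IndepVar p → DepVar q),
    IsOpen Ω → IsConnected Ω → closure Ω ⊆ Ω₀ → ContDiffOn ℝ ∞ f Ω → Ω.graphOn f ⊆ M →
    A.IsTransform g Ω f Ω' f' → Ω' ⊆ Ω₀ →
    (IntegrableOn (fun x => L (x, prolongFun n f' x)) Ω' ↔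
      IntegrableOn (fun x => L (x, prolongFun n f x)) Ω) ∧
    ∫ x in Ω', L (x, prolongFun n f' x) = ∫ x in Ω, L (x, prolongFun n f x)

end LocalTransformationGroup

end VarSym

end

/-!
Pull the Lagrangian back along the prolonged action: `(L ∘ pr^(n) g) (z) · det J_g (z)`. Since jets
of compositions depend only on jets, prolongation is functorial, and the pullback is a cocycle: for
`k` near the identity, its value at `k h` and `z` is its value at `k` and `pr^(n) h · z` times
`det J_h (z)`. Prolongation is also smooth in the group parameter, and the derivative of the
pullback at the identity, in the direction of a generator `v`, is `pr^(n) v (L) + L Div ξ`.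

If this derivative vanishes at every jet, then the cocycle property makes the derivative vanish also
at group elements close to the identity, so that the pullback is equal to `L` there; using the
cocycle property once more, the set on which it equals `L` is open and closed in the connected
`prolongedDomain`. There `det J_g` is positive, and equality of the integrals is the change of
variables formula. Conversely, the change of variables formula on small balls around a point, where
every `g` close to the identity transforms a function with a given jet, recovers the equality of the
integrands.
-/

namespace VarSym

/-! ### Jets of maps between normed spaces -/

section Jets

variable {𝕜 E F H : Type*} [NontriviallyNormedField 𝕜] [NormedAddCommGroup E] [NormedSpace 𝕜 E]
  [NormedAddCommGroup F] [NormedSpace 𝕜 F] [NormedAddCommGroup H] [NormedSpace 𝕜 H]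
  {n : ℕ} {x : E}

variable (𝕜) in
/-- Two functions have the same `n`-jet at `x`: their derivatives of order at most `n` agree. -/
def SameJet (n : ℕ) (f g : E → F) (x : E) : Prop :=
  ∀ k ≤ n, iteratedFDeriv 𝕜 k f x = iteratedFDeriv 𝕜 k g x

namespace SameJet

variable {f g k f₁ f₂ : E → F} {g₁ g₂ : F → H}

theorem refl (n : ℕ) (f : E → F) (x : E) : SameJet 𝕜 n f f x := fun _ _ => rfl

theorem symm (h : SameJet 𝕜 n f g x) : SameJet 𝕜 n g f x := fun i hi => (h i hi).symm

theorem trans (h : SameJet 𝕜 n f g x) (h' : SameJet 𝕜 n g k x) : SameJet 𝕜 n f k x :=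
  fun i hi => (h i hi).trans (h' i hi)

theorem of_eventuallyEq (h : f =ᶠ[𝓝 x] g) : SameJet 𝕜 n f g x :=
  fun _ _ => (h.iteratedFDeriv 𝕜 _).self_of_nhds

theorem apply_eq (h : SameJet 𝕜 n f g x) : f x = g x := by
  simpa using congrArg (fun m => m 0) (h 0 n.zero_le)

theorem fderiv_eq (hn : 1 ≤ n) (h : SameJet 𝕜 n f g x) : fderiv 𝕜 f x = fderiv 𝕜 g x := by
  ext v
  simpa [iteratedFDeriv_one_apply] using congrArg (fun m => m fun _ => v) (h 1 hn)

-- By Faà di Bruno's formula, the `n`-jet of a composition is a function of the two `n`-jets.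
theorem comp (hf : SameJet 𝕜 n f₁ f₂ x) (hg : SameJet 𝕜 n g₁ g₂ (f₁ x))
    (hf₁ : ContDiffAt 𝕜 n f₁ x) (hf₂ : ContDiffAt 𝕜 n f₂ x)
    (hg₁ : ContDiffAt 𝕜 n g₁ (f₁ x)) (hg₂ : ContDiffAt 𝕜 n g₂ (f₁ x)) :
    SameJet 𝕜 n (g₁ ∘ f₁) (g₂ ∘ f₂) x := by
  intro k hk
  have hk' : (k : ℕ∞ω) ≤ n := mod_cast hk
  rw [iteratedFDeriv_comp hg₁ hf₁ hk', iteratedFDeriv_comp (hf.apply_eq ▸ hg₂) hf₂ hk',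
    ← hf.apply_eq]
  simp only [FormalMultilinearSeries.taylorComp,
    FormalMultilinearSeries.compAlongOrderedFinpartition, ftaylorSeries]
  refine Finset.sum_congr rfl fun c _ => ?_
  rw [hg _ (c.length_le.trans hk)]
  congr 1
  funext m
  exact hf _ ((c.partSize_le m).trans hk)

theorem clm_comp (h : SameJet 𝕜 n f₁ f₂ x) (hf₁ : ContDiffAt 𝕜 n f₁ x)
    (hf₂ : ContDiffAt 𝕜 n f₂ x) (T : F →L[𝕜] H) : SameJet 𝕜 n (T ∘ f₁) (T ∘ f₂) x :=
  h.comp (refl n T _) hf₁ hf₂ T.contDiff.contDiffAt T.contDiff.contDiffAt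

theorem prodMk {g₁ g₂ : E → H} (hf : SameJet 𝕜 n f₁ f₂ x) (hg : SameJet 𝕜 n g₁ g₂ x)
    (hf₁ : ContDiffAt 𝕜 n f₁ x) (hf₂ : ContDiffAt 𝕜 n f₂ x)
    (hg₁ : ContDiffAt 𝕜 n g₁ x) (hg₂ : ContDiffAt 𝕜 n g₂ x) :
    SameJet 𝕜 n (fun y => (f₁ y, g₁ y)) (fun y => (f₂ y, g₂ y)) x := by
  intro k hk
  have hk' : (k : ℕ∞ω) ≤ n := mod_cast hk
  rw [iteratedFDeriv_prodMk hf₁ hg₁ hk', iteratedFDeriv_prodMk hf₂ hg₂ hk', hf k hk, hg k hk]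

theorem of_comp_right {a : E → F} {r : F → E} (h : SameJet 𝕜 n (g₁ ∘ a) (g₂ ∘ a) x)
    (h₁ : ContDiffAt 𝕜 n (g₁ ∘ a) x) (h₂ : ContDiffAt 𝕜 n (g₂ ∘ a) x) (hrx : r (a x) = x)
    (hr : ContDiffAt 𝕜 n r (a x)) (har : ∀ᶠ y in 𝓝 (a x), a (r y) = y) :
    SameJet 𝕜 n g₁ g₂ (a x) := by
  have hcomp : SameJet 𝕜 n ((g₁ ∘ a) ∘ r) ((g₂ ∘ a) ∘ r) (a x) :=
    (refl n r (a x)).comp (hrx.symm ▸ h) hr hr (hrx.symm ▸ h₁) (hrx.symm ▸ h₂)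
  have hcancel (g : F → H) : (g ∘ a) ∘ r =ᶠ[𝓝 (a x)] g := har.mono fun y hy => congrArg g hy
  exact (of_eventuallyEq (hcancel g₁)).symm.trans (hcomp.trans (of_eventuallyEq (hcancel g₂)))

end SameJet

end Jets

/-! ### Differential calculus -/

section Det

variable {𝕜 ι V : Type*} [NontriviallyNormedField 𝕜] [Fintype ι] [DecidableEq ι]
  [NormedAddCommGroup V] [NormedSpace 𝕜 V]

theorem det_comp (D₁ D₂ : V →L[𝕜] V) : (D₁.comp D₂).det = D₁.det * D₂.det :=
  LinearMap.det_comp _ _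

theorem hasDerivAt_det_one_add_smul (A : Matrix ι ι 𝕜) :
    HasDerivAt (fun t : 𝕜 => (1 + t • A).det) A.trace 0 := by
  rw [funext fun t => Matrix.det_one_add_smul t A]
  refine ((((hasDerivAt_id (0 : 𝕜)).const_mul A.trace).const_add 1).add
    ((Polynomial.hasDerivAt _ 0).mul (hasDerivAt_pow 2 (0 : 𝕜)))).congr_deriv ?_
  simp

variable [CompleteSpace 𝕜] [FiniteDimensional 𝕜 V]

theorem contDiff_det {m : ℕ∞ω} : ContDiff 𝕜 m fun D : V →L[𝕜] V => D.det := by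
  let b := Module.finBasis 𝕜 V
  have hdet (D : V →L[𝕜] V) : D.det = (Matrix.of fun i j => b.coord i (D (b j))).det := by
    rw [ContinuousLinearMap.det, ← LinearMap.det_toMatrix b]
    congr 1
    ext i j
    simp [LinearMap.toMatrix_apply]
  simp only [hdet, Matrix.det_apply, Matrix.of_apply]
  refine ContDiff.sum fun σ _ => ContDiff.const_smul _ (contDiff_prod fun i _ => ?_)
  exact (LinearMap.toContinuousLinearMap (b.coord (σ i))).contDiff.comp
    (contDiff_id.clm_apply contDiff_const)

theorem fderiv_det_id (K : V →L[𝕜] V) :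
    fderiv 𝕜 (fun D : V →L[𝕜] V => D.det) (ContinuousLinearMap.id 𝕜 V) K =
      LinearMap.trace 𝕜 V K := by
  let b := Module.finBasis 𝕜 V
  have hline : HasDerivAt (fun t : 𝕜 => (ContinuousLinearMap.id 𝕜 V + t • K).det)
      (fderiv 𝕜 (fun D : V →L[𝕜] V => D.det) (ContinuousLinearMap.id 𝕜 V) K) 0 :=
    ((contDiff_det.differentiable one_ne_zero _).hasFDerivAt.hasLineDerivAt K)
  have hmatrix (t : 𝕜) : (ContinuousLinearMap.id 𝕜 V + t • K).det =
      (1 + t • LinearMap.toMatrix b b K).det := by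
    rw [ContinuousLinearMap.det, ← LinearMap.det_toMatrix b]
    simp
  rw [funext hmatrix] at hline
  rw [hline.unique (hasDerivAt_det_one_add_smul _), LinearMap.trace_eq_matrix_trace 𝕜 b]

end Det

section InverseFunction

variable {𝕜 E V W : Type*} [RCLike 𝕜] [NormedAddCommGroup E] [NormedSpace 𝕜 E]
  [NormedAddCommGroup V] [NormedSpace 𝕜 V] [NormedAddCommGroup W] [NormedSpace 𝕜 W]

theorem isInvertible_of_det_ne_zero [FiniteDimensional 𝕜 V] {D : V →L[𝕜] V} (hD : D.det ≠ 0) :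
    D.IsInvertible :=
  ⟨D.toContinuousLinearEquivOfDetNeZero hD, by ext; rfl⟩

theorem isInvertible_fst_prod {T : E × V →L[𝕜] W}
    (hT : (T ∘L ContinuousLinearMap.inr 𝕜 E V).IsInvertible) :
    ((ContinuousLinearMap.fst 𝕜 E V).prod T).IsInvertible := by
  obtain ⟨S, hS⟩ := hT
  have hTS (a : E) (v : V) : T (a, v) = T (a, 0) + S v := by
    have hv : S v = T (0, v) := DFunLike.congr_fun hS v
    rw [hv, ← map_add, Prod.mk_add_mk, add_zero, zero_add]
  let R : E × W →L[𝕜] E × V := (ContinuousLinearMap.fst 𝕜 E W).prod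
    ((S.symm : W →L[𝕜] V) ∘L (ContinuousLinearMap.snd 𝕜 E W -
      T ∘L ContinuousLinearMap.inl 𝕜 E V ∘L ContinuousLinearMap.fst 𝕜 E W))
  refine ContinuousLinearMap.IsInvertible.of_inverse (g := R) ?_ ?_ <;>
    refine ContinuousLinearMap.ext fun y => Prod.ext rfl ?_
  · have hy : T (y.1, S.symm (y.2 - T (y.1, 0))) = y.2 := by
      rw [hTS, S.apply_symm_apply, add_sub_cancel]
    simpa [R] using hy
  · have hy : S.symm (T (y.1, y.2) - T (y.1, 0)) = y.2 := by
      rw [hTS, add_sub_cancel_left, S.symm_apply_apply]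
    simpa [R] using hy

variable [CompleteSpace V] {m : ℕ∞ω} {H : V → W} {x : V}

theorem exists_openPartialHomeomorph_contDiffOn_symm (hm : m ≠ 0) {O : Set V} (hO : IsOpen O)
    (hH : ContDiffOn 𝕜 m H O) (hx : x ∈ O) (hD : (fderiv 𝕜 H x).IsInvertible) :
    ∃ e : OpenPartialHomeomorph V W, x ∈ e.source ∧ e.source ⊆ O ∧ ⇑e = H ∧
      ContDiffOn 𝕜 m e.symm e.target := by
  obtain ⟨D, hD⟩ := hD
  have hHO {y : V} (hy : y ∈ O) : ContDiffAt 𝕜 m H y := hH.contDiffAt (hO.mem_nhds hy)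
  have hDx : HasFDerivAt H (D : V →L[𝕜] W) x :=
    hD ▸ ((hHO hx).differentiableAt hm).hasFDerivAt
  have hinv : IsOpen (O ∩ fderiv 𝕜 H ⁻¹' range ((↑) : (V ≃L[𝕜] W) → V →L[𝕜] W)) :=
    (hH.continuousOn_fderiv_of_isOpen hO
      (ENat.one_le_iff_ne_zero_withTop.2 hm)).isOpen_inter_preimage hO ContinuousLinearEquiv.isOpen
  let e := ((hHO hx).toOpenPartialHomeomorph H hDx hm).restrOpen _ hinv
  refine ⟨e, ⟨(hHO hx).mem_toOpenPartialHomeomorph_source hDx hm, hx, D, hD⟩,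
    fun y hy => hy.2.1, rfl, fun y hy => ContDiffAt.contDiffWithinAt ?_⟩
  obtain ⟨-, hyO, D', hD'⟩ := e.map_target hy
  refine e.contDiffAt_symm (f₀' := D') hy ?_ (hHO hyO)
  rw [hD']
  exact ((hHO hyO).differentiableAt hm).hasFDerivAt

theorem exists_contDiffAt_local_inverse (hm : m ≠ 0) (hH : ContDiffAt 𝕜 m H x)
    (hD : (fderiv 𝕜 H x).IsInvertible) :
    ∃ r : W → V, r (H x) = x ∧ ContDiffAt 𝕜 m r (H x) ∧
      (∀ᶠ y in 𝓝 x, r (H y) = y) ∧ ∀ᶠ y in 𝓝 (H x), H (r y) = y := by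
  obtain ⟨D, hD⟩ := hD
  have hDx : HasFDerivAt H (D : V →L[𝕜] W) x := hD ▸ (hH.differentiableAt hm).hasFDerivAt
  have hs := hH.hasStrictFDerivAt' hDx hm
  exact ⟨hH.localInverse hDx hm, hH.localInverse_apply_image hDx hm,
    hH.to_localInverse hDx hm, hs.eventually_left_inverse, hs.eventually_right_inverse⟩

end InverseFunction

section MixedPartials

variable {𝕜 E V W : Type*} [RCLike 𝕜] [NormedAddCommGroup E] [NormedSpace 𝕜 E]
  [NormedAddCommGroup V] [NormedSpace 𝕜 V] [NormedAddCommGroup W] [NormedSpace 𝕜 W]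
  {Ψ : E × V → W} {a : E} {m : V}

theorem fderiv_slice_left (h : DifferentiableAt 𝕜 Ψ (a, m)) :
    fderiv 𝕜 (fun b => Ψ (b, m)) a = fderiv 𝕜 Ψ (a, m) ∘L ContinuousLinearMap.inl 𝕜 E V :=
  (HasFDerivAt.comp (g := Ψ) (f := fun b => (b, m)) a h.hasFDerivAt
    (hasFDerivAt_prodMk_left a m)).fderiv

theorem fderiv_slice_right (h : DifferentiableAt 𝕜 Ψ (a, m)) :
    fderiv 𝕜 (fun m' => Ψ (a, m')) m = fderiv 𝕜 Ψ (a, m) ∘L ContinuousLinearMap.inr 𝕜 E V :=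
  (HasFDerivAt.comp (g := Ψ) (f := fun m' => (a, m')) m h.hasFDerivAt
    (hasFDerivAt_prodMk_right a m)).fderiv

theorem fderiv_fderiv_comm (h : ContDiffAt 𝕜 2 Ψ (a, m)) (w : E) (y : V) :
    fderiv 𝕜 (fun b => fderiv 𝕜 (fun m' => Ψ (b, m')) m y) a w =
      fderiv 𝕜 (fun m' => fderiv 𝕜 (fun b => Ψ (b, m')) a w) m y := by
  have hev : ∀ᶠ u in 𝓝 (a, m), DifferentiableAt 𝕜 Ψ u :=
    (h.eventually (by simp)).mono fun u hu => hu.differentiableAt (by simp)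
  have hd : DifferentiableAt 𝕜 (fderiv 𝕜 Ψ) (a, m) :=
    (h.fderiv_right (m := 1) (by norm_num)).differentiableAt one_ne_zero
  have hleft : (fun b => fderiv 𝕜 (fun m' => Ψ (b, m')) m y) =ᶠ[𝓝 a]
      fun b => fderiv 𝕜 Ψ (b, m) (0, y) := by
    have hc : ContinuousAt (fun b : E => (b, m)) a := by fun_prop
    filter_upwards [hc.eventually hev] with b hb
    rw [fderiv_slice_right hb]
    rfl
  have hright : (fun m' => fderiv 𝕜 (fun b => Ψ (b, m')) a w) =ᶠ[𝓝 m]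
      fun m' => fderiv 𝕜 Ψ (a, m') (w, 0) := by
    have hc : ContinuousAt (fun m' : V => (a, m')) m := by fun_prop
    filter_upwards [hc.eventually hev] with m' hm'
    rw [fderiv_slice_left hm']
    rfl
  have happly (u : E × V) : DifferentiableAt 𝕜 (fun v => fderiv 𝕜 Ψ v u) (a, m) :=
    hd.clm_apply (differentiableAt_const u)
  rw [hleft.fderiv_eq, hright.fderiv_eq, fderiv_slice_left (happly _),
    fderiv_slice_right (happly _)]
  simpa [fderiv_clm_apply hd] using h.isSymmSndFDerivAt (by simp) (w, 0) (0, y)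

end MixedPartials

section IntegralCurves

variable {V : Type*} [NormedAddCommGroup V] [NormedSpace ℝ V] {v : V → V} {γ₁ γ₂ : ℝ → V}
  {a b : ℝ}

theorem exists_lipschitzOnWith_of_contDiffAt {W : Type*} [NormedAddCommGroup W]
    [NormedSpace ℝ W] {f : V → W} {C : Set V} (hC : IsCompact C)
    (hf : ∀ x ∈ C, ContDiffAt ℝ 1 f x) : ∃ K, LipschitzOnWith K f C :=
  LocallyLipschitzOn.exists_lipschitzOnWith_of_compact hC fun x hx =>
    have ⟨K, t, ht, hK⟩ := (hf x hx).exists_lipschitzOnWith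
    ⟨K, t, nhdsWithin_le_nhds ht, hK⟩

theorem eqOn_uIcc_of_isIntegralCurveOn (hγ₁ : IsIntegralCurveOn γ₁ (fun _ => v) (uIcc a b))
    (hγ₂ : IsIntegralCurveOn γ₂ (fun _ => v) (uIcc a b))
    (hv₁ : ∀ t ∈ uIcc a b, ContDiffAt ℝ 1 v (γ₁ t))
    (hv₂ : ∀ t ∈ uIcc a b, ContDiffAt ℝ 1 v (γ₂ t)) (h : γ₁ a = γ₂ a) :
    EqOn γ₁ γ₂ (uIcc a b) := by
  obtain ⟨K, hK⟩ := exists_lipschitzOnWith_of_contDiffAt (f := v)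
    ((isCompact_uIcc.image_of_continuousOn hγ₁.continuousOn).union
      (isCompact_uIcc.image_of_continuousOn hγ₂.continuousOn))
    (by rintro _ (⟨t, ht, rfl⟩ | ⟨t, ht, rfl⟩); exacts [hv₁ t ht, hv₂ t ht])
  have hmem₁ (t : ℝ) (ht : t ∈ uIcc a b) : γ₁ t ∈ γ₁ '' uIcc a b ∪ γ₂ '' uIcc a b :=
    .inl (mem_image_of_mem _ ht)
  have hmem₂ (t : ℝ) (ht : t ∈ uIcc a b) : γ₂ t ∈ γ₁ '' uIcc a b ∪ γ₂ '' uIcc a b :=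
    .inr (mem_image_of_mem _ ht)
  rcases le_total a b with hab | hba
  · rw [uIcc_of_le hab] at *
    have hderiv {γ : ℝ → V} (hγ : IsIntegralCurveOn γ (fun _ => v) (Icc a b)) :
        ∀ t ∈ Ico a b, HasDerivWithinAt γ (v (γ t)) (Ici t) t := fun t ht =>
      (hγ t (Ico_subset_Icc_self ht)).mono_of_mem_nhdsWithin
        (Filter.mem_of_superset (Icc_mem_nhdsGE ht.2) (Icc_subset_Icc_left ht.1))
    exact ODE_solution_unique_of_mem_Icc_right (fun _ _ => hK) hγ₁.continuousOn (hderiv hγ₁)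
      (fun t ht => hmem₁ t (Ico_subset_Icc_self ht)) hγ₂.continuousOn (hderiv hγ₂)
      (fun t ht => hmem₂ t (Ico_subset_Icc_self ht)) h
  · rw [uIcc_of_ge hba] at *
    have hderiv {γ : ℝ → V} (hγ : IsIntegralCurveOn γ (fun _ => v) (Icc b a)) :
        ∀ t ∈ Ioc b a, HasDerivWithinAt γ (v (γ t)) (Iic t) t := fun t ht =>
      (hγ t (Ioc_subset_Icc_self ht)).mono_of_mem_nhdsWithin
        (Filter.mem_of_superset (Icc_mem_nhdsLE ht.1) (Icc_subset_Icc_right ht.2))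
    exact ODE_solution_unique_of_mem_Icc_left (fun _ _ => hK) hγ₁.continuousOn (hderiv hγ₁)
      (fun t ht => hmem₁ t (Ioc_subset_Icc_self ht)) hγ₂.continuousOn (hderiv hγ₂)
      (fun t ht => hmem₂ t (Ioc_subset_Icc_self ht)) h

end IntegralCurves

theorem eventually_eq_of_eventually_fderiv_eq_zero {𝕜 E W : Type*} [RCLike 𝕜]
    [NormedAddCommGroup E] [NormedSpace 𝕜 E] [NormedAddCommGroup W] [NormedSpace 𝕜 W]
    {T : E → W} {a : E} (hT : ∀ᶠ b in 𝓝 a, DifferentiableAt 𝕜 T b)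
    (hT' : ∀ᶠ b in 𝓝 a, fderiv 𝕜 T b = 0) : ∀ᶠ b in 𝓝 a, T b = T a := by
  let _ : NormedSpace ℝ E := NormedSpace.restrictScalars ℝ 𝕜 E
  obtain ⟨ε, hε, hball⟩ := Metric.eventually_nhds_iff_ball.1 (hT.and hT')
  filter_upwards [Metric.ball_mem_nhds a hε] with b hb
  exact Metric.isOpen_ball.is_const_of_fderiv_eq_zero (convex_ball a ε).isPreconnected
    (fun c hc => (hball c hc).1.differentiableWithinAt) (fun c hc => (hball c hc).2) hb
    (Metric.mem_ball_self hε)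

/-! ### Connectedness and averages over balls -/

theorem eq_of_isPreconnected_of_eventually_mul {G α : Type*} [TopologicalSpace G] [Group G]
    [IsTopologicalGroup G] {S : Set G} (hS : IsPreconnected S) {F : G → α}
    (hF : ∀ h ∈ S, ∀ᶠ k in 𝓝 (1 : G), F (k * h) = F h) {g h : G} (hg : g ∈ S) (hh : h ∈ S) :
    F g = F h := by
  refine hS.induction₂' (fun g h => F g = F h) (fun h hh => ?_)
    (fun _ _ _ _ _ _ => Eq.trans) hg hh
  refine Filter.Eventually.filter_mono nhdsWithin_le_nhds ?_
  rw [← map_mul_right_nhds_one h]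
  exact (hF h hh).mono fun k hk => ⟨hk.symm, hk⟩

theorem eventually_mem_connectedComponentIn {X Y : Type*} [TopologicalSpace X]
    [LocallyConnectedSpace X] [TopologicalSpace Y] {S : Y → Set X} {a : X} {y : Y}
    (h : ∀ᶠ b in 𝓝 (a, y), b.1 ∈ S b.2) :
    ∀ᶠ b in 𝓝 (a, y), b.1 ∈ connectedComponentIn (S b.2) a := by
  rw [nhds_prod_eq] at h ⊢
  obtain ⟨P, hP, Q, hQ, hPQ⟩ := Filter.eventually_prod_iff.1 h
  filter_upwards [Filter.Eventually.prod_mk (connectedComponentIn_mem_nhds hP) hQ] with b hb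
  exact isPreconnected_connectedComponentIn.subset_connectedComponentIn
    (mem_connectedComponentIn hP.self_of_nhds)
    (fun c hc => hPQ (connectedComponentIn_subset {c | P c} a hc) hb.2) hb.1

theorem eq_of_setIntegral_ball_eq {X E : Type*} [PseudoMetricSpace X] [MeasurableSpace X]
    [OpensMeasurableSpace X] [SecondCountableTopology X] {μ : Measure X}
    [IsLocallyFiniteMeasure μ] [μ.IsOpenPosMeasure] [NormedAddCommGroup E] [NormedSpace ℝ E]
    [CompleteSpace E] {F H : X → E} {x : X} {s : Set X} (hs : IsOpen s) (hx : x ∈ s)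
    (hF : ContinuousOn F s) (hH : ContinuousOn H s) (h : ∀ᶠ r in 𝓝[>] (0 : ℝ),
      ∫ y in Metric.ball x r, F y ∂μ = ∫ y in Metric.ball x r, H y ∂μ) : F x = H x := by
  have hballs : Filter.Tendsto (Metric.ball x) (𝓝[>] 0) (𝓝 x).smallSets :=
    ((tendsto_closedBall_smallSets x).smallSets_mono
      (.of_forall fun _ => Metric.ball_subset_closedBall)).mono_left nhdsWithin_le_nhds
  have hdiff : (fun r => μ.real (Metric.ball x r) • (H x - F x)) =o[𝓝[>] 0]
      fun r => μ.real (Metric.ball x r) := by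
    refine (((hF.continuousAt (hs.mem_nhds hx)).integral_sub_linear_isLittleO_ae
      (hF.stronglyMeasurableAtFilter hs x hx) hballs).sub
        ((hH.continuousAt (hs.mem_nhds hx)).integral_sub_linear_isLittleO_ae
          (hH.stronglyMeasurableAtFilter hs x hx) hballs)).congr' ?_ .rfl
    filter_upwards [h] with r hr
    rw [hr, smul_sub, sub_sub_sub_cancel_left]
  have hpos : ∀ᶠ r in 𝓝[>] (0 : ℝ), 0 < μ.real (Metric.ball x r) := by
    filter_upwards [hballs.eventually (μ.finiteAt_nhds x).eventually, self_mem_nhdsWithin]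
      with r hr hr0
    exact ENNReal.toReal_pos (Metric.measure_ball_pos μ x hr0).ne' hr.ne
  refine (sub_eq_zero.1 (norm_le_zero_iff.1 (le_of_forall_pos_le_add fun ε hε => ?_))).symm
  obtain ⟨r, hr, hr0⟩ := ((hdiff.bound hε).and hpos).exists
  rw [norm_smul, mul_comm] at hr
  simpa using le_of_mul_le_mul_right hr (norm_pos_iff.2 hr0.ne')

/-! ### Lie groups in coordinates near the identity -/

section GroupCoordinates

variable (E G : Type*) [NormedAddCommGroup E] [TopologicalSpace G] [ChartedSpace E G] [Group G]

/-- The chart of a Lie group at the identity, through which the group is described by coordinates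
in the model space near the identity. -/
abbrev chartOne : OpenPartialHomeomorph G E := chartAt E 1

/-- The coordinates of the identity, which need not be `0`. -/
def coordOne : E := chartOne E G 1

/-- The group multiplication in coordinates near the identity. -/
def coordMul (y : E × E) : E := chartOne E G ((chartOne E G).symm y.1 * (chartOne E G).symm y.2)

variable {E G}

theorem coordOne_mem_target : coordOne E G ∈ (chartOne E G).target := mem_chart_target E 1

theorem chartOne_symm_coordOne : (chartOne E G).symm (coordOne E G) = 1 :=
  (chartOne E G).left_inv (mem_chart_source E 1)

theorem eventually_coordOne_iff {P : G → Prop} :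
    (∀ᶠ a in 𝓝 (coordOne E G), P ((chartOne E G).symm a)) ↔ ∀ᶠ g in 𝓝 1, P g :=
  (chartOne E G).eventually_nhds' P (mem_chart_source E 1)

theorem coordMul_coordOne_left {a : E} (ha : a ∈ (chartOne E G).target) :
    coordMul E G (coordOne E G, a) = a := by
  rw [coordMul, chartOne_symm_coordOne, one_mul, (chartOne E G).right_inv ha]

theorem coordMul_coordOne_right {a : E} (ha : a ∈ (chartOne E G).target) :
    coordMul E G (a, coordOne E G) = a := by
  rw [coordMul, chartOne_symm_coordOne, mul_one, (chartOne E G).right_inv ha]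

variable [NormedSpace ℝ E]

variable (E G) in
/-- The derivative at the identity of the right translation by the group element with coordinates
`b`. -/
noncomputable def rightTranslation (b : E) : E →L[ℝ] E :=
  fderiv ℝ (coordMul E G) (coordOne E G, b) ∘L ContinuousLinearMap.inl ℝ E E

variable [LieGroup 𝓘(ℝ, E) ∞ G] {b : E}

theorem eventually_chartOne_symm_coordMul (hb : b ∈ (chartOne E G).target) :
    ∀ᶠ a in 𝓝 (coordOne E G), (chartOne E G).symm (coordMul E G (a, b)) =
      (chartOne E G).symm a * (chartOne E G).symm b := by
  have : IsTopologicalGroup G := topologicalGroup_of_lieGroup 𝓘(ℝ, E) ∞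
  have hc : ContinuousAt (fun g => g * (chartOne E G).symm b) 1 := by fun_prop
  refine eventually_coordOne_iff.2 ((hc.eventually ((chartOne E G).open_source.mem_nhds ?_)).mono
    fun g hg => (chartOne E G).left_inv hg)
  simpa using (chartOne E G).map_target hb

theorem contDiffAt_coordMul (hb : b ∈ (chartOne E G).target) :
    ContDiffAt ℝ ∞ (coordMul E G) (coordOne E G, b) := by
  rw [← contMDiffAt_iff_contDiffAt]
  have hfst : ContMDiffAt 𝓘(ℝ, E × E) 𝓘(ℝ, E) ∞
      (fun y : E × E => (chartOne E G).symm y.1) (coordOne E G, b) :=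
    (contMDiffOn_chart_symm.contMDiffAt ((chartOne E G).open_target.mem_nhds
      coordOne_mem_target)).comp (coordOne E G, b) contDiffAt_fst.contMDiffAt
  have hsnd : ContMDiffAt 𝓘(ℝ, E × E) 𝓘(ℝ, E) ∞
      (fun y : E × E => (chartOne E G).symm y.2) (coordOne E G, b) :=
    (contMDiffOn_chart_symm.contMDiffAt ((chartOne E G).open_target.mem_nhds hb)).comp
      (coordOne E G, b) contDiffAt_snd.contMDiffAt
  have hchart : ContMDiffAt 𝓘(ℝ, E) 𝓘(ℝ, E) ∞ (chartOne E G)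
      ((chartOne E G).symm (coordOne E G) * (chartOne E G).symm b) := by
    rw [chartOne_symm_coordOne, one_mul]
    exact contMDiffOn_chart.contMDiffAt
      ((chartOne E G).open_source.mem_nhds ((chartOne E G).map_target hb))
  exact ContMDiffAt.comp (coordOne E G, b) hchart (hfst.mul hsnd)

theorem hasFDerivAt_coordMul_left (hb : b ∈ (chartOne E G).target) :
    HasFDerivAt (fun a => coordMul E G (a, b)) (rightTranslation E G b) (coordOne E G) :=
  HasFDerivAt.comp (f := fun a => (a, b)) (coordOne E G)
    ((contDiffAt_coordMul hb).differentiableAt (by simp)).hasFDerivAt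
    (hasFDerivAt_prodMk_left _ _)

theorem contDiffAt_rightTranslation (hb : b ∈ (chartOne E G).target) :
    ContDiffAt ℝ ∞ (rightTranslation E G) b :=
  (ContDiffAt.comp b ((contDiffAt_coordMul hb).fderiv_right (by simp))
    (contDiffAt_const.prodMk contDiffAt_id)).clm_comp contDiffAt_const

theorem rightTranslation_coordOne :
    rightTranslation E G (coordOne E G) = ContinuousLinearMap.id ℝ E := by
  refine (hasFDerivAt_coordMul_left coordOne_mem_target).unique
    ((hasFDerivAt_id _).congr_of_eventuallyEq ?_)
  filter_upwards [(chartOne E G).open_target.mem_nhds coordOne_mem_target] with a ha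
  exact coordMul_coordOne_right ha

theorem eventually_isInvertible_rightTranslation [CompleteSpace E] :
    ∀ᶠ b in 𝓝 (coordOne E G), (rightTranslation E G b).IsInvertible := by
  refine (contDiffAt_rightTranslation coordOne_mem_target).continuousAt.eventually
    (ContinuousLinearEquiv.isOpen.mem_nhds ⟨ContinuousLinearEquiv.refl ℝ E, ?_⟩)
  rw [rightTranslation_coordOne]
  rfl

theorem fderiv_comp_rightTranslation {W : Type*} [NormedAddCommGroup W] [NormedSpace ℝ W]
    {S T : E → W} (hb : b ∈ (chartOne E G).target) (hT : DifferentiableAt ℝ T b)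
    (h : ∀ᶠ a in 𝓝 (coordOne E G), T (coordMul E G (a, b)) = S a) :
    fderiv ℝ T b ∘L rightTranslation E G b = fderiv ℝ S (coordOne E G) := by
  have hT' : HasFDerivAt T (fderiv ℝ T b) (coordMul E G (coordOne E G, b)) := by
    rw [coordMul_coordOne_left hb]
    exact hT.hasFDerivAt
  rw [← Filter.EventuallyEq.fderiv_eq h]
  exact (hT'.comp (coordOne E G) (hasFDerivAt_coordMul_left hb)).fderiv.symm

theorem exists_hasDerivAt_rightTranslation [CompleteSpace E] (w : E) :
    ∃ c : ℝ → E, c 0 = coordOne E G ∧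
      ∀ᶠ t in 𝓝 0, HasDerivAt c (rightTranslation E G (c t) w) t := by
  have hfield : ContDiffAt ℝ 1 (fun b => rightTranslation E G b w) (coordOne E G) :=
    ((contDiffAt_rightTranslation coordOne_mem_target).clm_apply contDiffAt_const).of_le (by simp)
  obtain ⟨c, hc0, ε, hε, hc⟩ :=
    hfield.exists_forall_mem_closedBall_exists_eq_forall_mem_Ioo_hasDerivAt₀ 0
  exact ⟨c, hc0, Filter.mem_of_superset (Ioo_mem_nhds (by linarith) (by linarith)) hc⟩

end GroupCoordinates

/-! ### Partial derivatives and Taylor polynomials -/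

variable {p q n : ℕ}

theorem isOpen_jetSet {M : Set (TotalSpace p q)} (hM : IsOpen M) : IsOpen (jetSet n M) :=
  hM.preimage (by unfold JetSpace.base; fun_prop)

section PartialDeriv

variable {f g : IndepVar p → DepVar q} {x : IndepVar p}

theorem partialDeriv_eq_iteratedFDeriv {l : List (Fin p)} {k : ℕ} (h : l.length = k)
    (v : Fin k → Fin p) (hv : ∀ i, l.get i = v (Fin.cast h i)) (f : IndepVar p → DepVar q)
    (x : IndepVar p) :
    partialDeriv l f x = iteratedFDeriv ℝ k f x fun i => Pi.single (v i) 1 := by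
  subst h
  simp only [partialDeriv, hv]
  rfl

theorem partialDeriv_nil (f : IndepVar p → DepVar q) (x : IndepVar p) :
    partialDeriv [] f x = f x := by
  simp [partialDeriv]

theorem partialDeriv_singleton (i : Fin p) (f : IndepVar p → DepVar q) (x : IndepVar p) :
    partialDeriv [i] f x = fderiv ℝ f x (Pi.single i 1) := by
  rw [partialDeriv_eq_iteratedFDeriv (k := 1) rfl (fun _ => i) (by simp), iteratedFDeriv_one_apply]

theorem partialDeriv_cons (i : Fin p) (l : List (Fin p))
    (hf : ContDiffAt ℝ (l.length + 1 : ℕ) f x) :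
    partialDeriv (i :: l) f x = fderiv ℝ (partialDeriv l f) x (Pi.single i 1) := by
  have hd : DifferentiableAt ℝ (iteratedFDeriv ℝ l.length f) x :=
    (hf.iteratedFDeriv_right (m := 1) (by push_cast; rw [add_comm])).differentiableAt one_ne_zero
  unfold partialDeriv
  rw [fderiv_continuousMultilinear_apply_const_apply hd]
  exact iteratedFDeriv_succ_apply_left (n := l.length) _

theorem eventually_partialDeriv_cons (i : Fin p) (l : List (Fin p))
    (hf : ContDiffAt ℝ (l.length + 1 : ℕ) f x) :
    partialDeriv (i :: l) f =ᶠ[𝓝 x] fun y => fderiv ℝ (partialDeriv l f) y (Pi.single i 1) :=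
  (hf.eventually (ENat.natCast_ne_coe_top _)).mono fun _ hy => partialDeriv_cons i l hy

theorem contDiffAt_partialDeriv (l : List (Fin p)) {m k : ℕ∞ω} (hf : ContDiffAt ℝ k f x)
    (hk : m + l.length ≤ k) : ContDiffAt ℝ m (partialDeriv l f) x :=
  (ContinuousMultilinearMap.apply ℝ (fun _ => IndepVar p) (DepVar q)
    (fun k => Pi.single (l.get k) 1)).contDiff.comp_contDiffAt x (hf.iteratedFDeriv_right hk)

theorem partialDeriv_cons_cons (i j : Fin p) (l : List (Fin p))
    (hf : ContDiffAt ℝ (l.length + 2 : ℕ) f x) :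
    partialDeriv (i :: j :: l) f x =
      fderiv ℝ (fderiv ℝ (partialDeriv l f)) x (Pi.single i 1) (Pi.single j 1) := by
  have hd : DifferentiableAt ℝ (fderiv ℝ (partialDeriv l f)) x :=
    ((contDiffAt_partialDeriv (m := 2) l hf (by push_cast; rw [add_comm])).fderiv_right (m := 1)
      (by norm_num)).differentiableAt one_ne_zero
  have hf' : ContDiffAt ℝ (l.length + 1 : ℕ) f x := hf.of_le (mod_cast Nat.le_succ _)
  rw [partialDeriv_cons i (j :: l) hf, (eventually_partialDeriv_cons j l hf').fderiv_eq,
    fderiv_clm_apply hd (by fun_prop)]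
  simp

theorem partialDeriv_swap (i j : Fin p) (l : List (Fin p))
    (hf : ContDiffAt ℝ (l.length + 2 : ℕ) f x) :
    partialDeriv (i :: j :: l) f x = partialDeriv (j :: i :: l) f x := by
  have hsymm : IsSymmSndFDerivAt ℝ (partialDeriv l f) x :=
    (contDiffAt_partialDeriv (m := 2) l hf (by push_cast; rw [add_comm])).isSymmSndFDerivAt
      (by simp)
  rw [partialDeriv_cons_cons i j l hf, partialDeriv_cons_cons j i l hf]
  exact hsymm _ _

theorem partialDeriv_perm {l₁ l₂ : List (Fin p)} (h : l₁.Perm l₂)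
    (hf : ContDiffAt ℝ l₁.length f x) : partialDeriv l₁ f x = partialDeriv l₂ f x := by
  induction h generalizing x with
  | nil => rfl
  | @cons i l₁ l₂ h ih =>
    have heq : partialDeriv l₁ f =ᶠ[𝓝 x] partialDeriv l₂ f :=
      (hf.eventually (ENat.natCast_ne_coe_top _)).mono fun y hy =>
        ih (hy.of_le (mod_cast Nat.le_succ _))
    rw [partialDeriv_cons i l₁ hf, partialDeriv_cons i l₂ (h.length_eq ▸ hf), heq.fderiv_eq]
  | swap i j l => exact partialDeriv_swap _ _ l hf
  | trans h₁ _ ih₁ ih₂ => exact (ih₁ hf).trans (ih₂ (h₁.length_eq ▸ hf))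

theorem contDiffAt_prolongFun (hf : ContDiffAt ℝ ∞ f x) : ContDiffAt ℝ ∞ (prolongFun n f) x :=
  contDiffAt_pi.2 fun _ => contDiffAt_partialDeriv _ hf (mod_cast le_top)

theorem prolongFun_ofFn {k : ℕ} (hk : k ≤ n) (v : Fin k → Fin p) (hf : ContDiffAt ℝ k f x) :
    prolongFun n f x ⟨⟨k, Nat.lt_succ_of_le hk⟩, ⟨(List.ofFn v : Multiset (Fin p)), by simp⟩⟩ =
      iteratedFDeriv ℝ k f x fun i => Pi.single (v i) 1 := by
  have hperm : ((List.ofFn v : Multiset (Fin p)).sort (· ≤ ·)).Perm (List.ofFn v) := by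
    rw [← Multiset.coe_eq_coe, Multiset.sort_eq]
  rw [← partialDeriv_eq_iteratedFDeriv (l := List.ofFn v) (by simp) v (by intro i; simp; rfl)]
  exact partialDeriv_perm hperm (hf.of_le (by simp))

theorem sameJet_iff_prolongFun_eq (hf : ContDiffAt ℝ n f x) (hg : ContDiffAt ℝ n g x) :
    SameJet ℝ n f g x ↔ prolongFun n f x = prolongFun n g x := by
  refine ⟨fun h => funext fun J => ?_, fun h k hk => ?_⟩
  · have hJ : ((J.2 : Multiset (Fin p)).sort (· ≤ ·)).length ≤ n := by
      simpa using Nat.le_of_lt_succ J.1.2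
    simp only [prolongFun, partialDeriv, h _ hJ]
  · have hk' : (k : ℕ∞ω) ≤ n := mod_cast hk
    refine ContinuousMultilinearMap.toMultilinearMap_injective
      (Module.Basis.ext_multilinear (fun _ => Pi.basisFun ℝ (Fin p)) fun v => ?_)
    simpa only [Pi.basisFun_apply, ContinuousMultilinearMap.coe_coe,
      prolongFun_ofFn hk v (hf.of_le hk'), prolongFun_ofFn hk v (hg.of_le hk')] using
        congrFun h ⟨⟨k, Nat.lt_succ_of_le hk⟩, ⟨(List.ofFn v : Multiset (Fin p)), by simp⟩⟩

end PartialDeriv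

section Taylor

/-- The monomial `(y - x)^κ / κ!`. -/
noncomputable def taylorMonomial (x : IndepVar p) (κ : Fin p → ℕ) (y : IndepVar p) : ℝ :=
  ∏ j, (y j - x j) ^ κ j / ((κ j).factorial : ℝ)

/-- The exponent vector of a multi-index: `J.exponent j` is the number of entries equal to `j`. -/
def MultiIndex.exponent (J : MultiIndex p n) (j : Fin p) : ℕ := (J.2 : Multiset (Fin p)).count j

theorem MultiIndex.exponent_injective :
    Function.Injective (MultiIndex.exponent : MultiIndex p n → Fin p → ℕ) := by
  rintro ⟨⟨j, hj⟩, s⟩ ⟨⟨k, hk⟩, t⟩ h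
  have hst : (s : Multiset (Fin p)) = t := Multiset.ext.2 (congrFun h)
  obtain rfl : j = k := by simpa using congrArg Multiset.card hst
  obtain rfl : s = t := Subtype.ext hst
  rfl

theorem contDiff_taylorMonomial (x : IndepVar p) (κ : Fin p → ℕ) {m : ℕ∞ω} :
    ContDiff ℝ m (taylorMonomial x κ) := by
  unfold taylorMonomial
  fun_prop

theorem contDiff_taylorMonomial_smul (x : IndepVar p) (κ : Fin p → ℕ) (c : DepVar q) {m : ℕ∞ω} :
    ContDiff ℝ m fun y => taylorMonomial x κ y • c :=
  (contDiff_taylorMonomial x κ).smul contDiff_const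

theorem taylorMonomial_self (x : IndepVar p) (κ : Fin p → ℕ) :
    taylorMonomial x κ x = if κ = 0 then 1 else 0 := by
  split_ifs with h
  · simp [taylorMonomial, h]
  · obtain ⟨j, hj⟩ := Function.ne_iff.1 h
    exact Finset.prod_eq_zero (Finset.mem_univ j) (by simp [zero_pow hj])

theorem hasDerivAt_pow_div_factorial (k : ℕ) (t : ℝ) :
    HasDerivAt (fun t : ℝ => t ^ k / (k.factorial : ℝ))
      (if k = 0 then 0 else t ^ (k - 1) / ((k - 1).factorial : ℝ)) t := by
  refine ((hasDerivAt_pow k t).div_const (k.factorial : ℝ)).congr_deriv ?_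
  cases k with
  | zero => simp
  | succ k =>
    have : (k.factorial : ℝ) ≠ 0 := by positivity
    rw [if_neg k.succ_ne_zero, Nat.add_sub_cancel, Nat.factorial_succ, Nat.cast_mul]
    field_simp

open Classical in
theorem fderiv_taylorMonomial (x : IndepVar p) (κ : Fin p → ℕ) (y : IndepVar p) (i : Fin p) :
    fderiv ℝ (taylorMonomial x κ) y (Pi.single i 1) =
      if Pi.single i 1 ≤ κ then taylorMonomial x (κ - Pi.single i 1) y else 0 := by
  have hfactor (j : Fin p) : HasFDerivAt
      (fun y : IndepVar p => (y j - x j) ^ κ j / ((κ j).factorial : ℝ))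
      ((if κ j = 0 then 0 else (y j - x j) ^ (κ j - 1) / ((κ j - 1).factorial : ℝ)) •
        ContinuousLinearMap.proj (R := ℝ) (φ := fun _ : Fin p => ℝ) j) y :=
    (hasDerivAt_pow_div_factorial (κ j) _).comp_hasFDerivAt y
      ((hasFDerivAt_apply j y).sub_const _)
  have hprod : HasFDerivAt (taylorMonomial x κ) _ y :=
    HasFDerivAt.finsetProd (u := Finset.univ) fun j _ => hfactor j
  rw [hprod.fderiv, sum_apply, Finset.sum_eq_single i (fun j _ hj => by simp [-ite_smul, hj])
    (by simp)]
  have hle : Pi.single i 1 ≤ κ ↔ κ i ≠ 0 := by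
    simp [Pi.single, update_le_iff, Nat.one_le_iff_ne_zero]
  by_cases hi : κ i = 0
  · simp [hle, hi]
  · rw [if_pos (hle.2 hi), taylorMonomial, ← Finset.prod_erase_mul _ _ (Finset.mem_univ i)]
    simp only [hi, if_false, smul_apply, ContinuousLinearMap.proj_apply, Pi.single_eq_same,
      smul_eq_mul, mul_one, Pi.sub_apply]
    congr 1
    refine Finset.prod_congr rfl fun j hj => ?_
    rw [Pi.single_eq_of_ne (Finset.ne_of_mem_erase hj), Nat.sub_zero]

theorem count_cons_eq_add_single (i : Fin p) (l : List (Fin p)) :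
    (fun j => (i :: l).count j) = (fun j => l.count j) + Pi.single i 1 := by
  funext j
  rw [List.count_cons, Pi.add_apply, Pi.single_apply]
  simp only [beq_iff_eq, @eq_comm _ j]

open Classical in
theorem partialDeriv_taylorMonomial_smul (x : IndepVar p) (κ : Fin p → ℕ) (c : DepVar q)
    (l : List (Fin p)) (y : IndepVar p) :
    partialDeriv l (fun y => taylorMonomial x κ y • c) y =
      if (fun j => l.count j) ≤ κ then taylorMonomial x (κ - fun j => l.count j) y • c
      else 0 := by
  induction l generalizing y with
  | nil => simp [partialDeriv_nil, Pi.le_def, Pi.sub_def]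
  | cons i l ih =>
    rw [partialDeriv_cons i l (contDiff_taylorMonomial_smul x κ c).contDiffAt,
      funext ih, count_cons_eq_add_single]
    by_cases h : (fun j => l.count j) ≤ κ
    · simp only [h, if_true]
      rw [fderiv_smul_const ((contDiff_taylorMonomial x _).differentiable one_ne_zero _),
        ContinuousLinearMap.smulRight_apply, fderiv_taylorMonomial, ite_smul, zero_smul,
        tsub_add_eq_tsub_tsub]
      exact if_congr (le_tsub_iff_left h) rfl rfl
    · rw [if_neg fun h' => h (le_self_add.trans h')]
      simp [h]

open Classical in
theorem partialDeriv_taylorMonomial_smul_self (x : IndepVar p) (κ : Fin p → ℕ) (c : DepVar q)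
    (l : List (Fin p)) :
    partialDeriv l (fun y => taylorMonomial x κ y • c) x =
      if (fun j => l.count j) = κ then c else 0 := by
  rw [partialDeriv_taylorMonomial_smul, taylorMonomial_self, ite_smul, one_smul, zero_smul,
    ← ite_and]
  simp only [tsub_eq_zero_iff_le, ← le_antisymm_iff]

theorem taylorFun_eq_sum (z : JetSpace p q n) :
    taylorFun z = fun y => ∑ J : MultiIndex p n, taylorMonomial z.1 J.exponent y • z.2 J := by
  funext y
  refine Finset.sum_congr rfl fun J _ => ?_
  rw [taylorMonomial, Finset.prod_div_distrib, Finset.prod_multiset_map_count, Nat.cast_prod]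
  congr 2
  refine Finset.prod_subset (Finset.subset_univ _) fun j _ hj => ?_
  rw [Multiset.count_eq_zero_of_notMem (by simpa using hj), pow_zero]

theorem contDiff_taylorFun (z : JetSpace p q n) {m : ℕ∞ω} : ContDiff ℝ m (taylorFun z) := by
  rw [taylorFun_eq_sum]
  exact ContDiff.sum fun J _ => contDiff_taylorMonomial_smul _ _ _

theorem partialDeriv_sum {ι : Type*} (s : Finset ι) (l : List (Fin p))
    {f : ι → IndepVar p → DepVar q} {x : IndepVar p}
    (hf : ∀ i ∈ s, ContDiffAt ℝ l.length (f i) x) :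
    partialDeriv l (fun y => ∑ i ∈ s, f i y) x = ∑ i ∈ s, partialDeriv l (f i) x := by
  unfold partialDeriv
  rw [iteratedFDeriv_fun_sum_apply hf, sum_apply]

theorem prolongFun_taylorFun (z : JetSpace p q n) : prolongFun n (taylorFun z) z.1 = z.2 := by
  funext J
  have hJ : (fun j => ((J.2 : Multiset (Fin p)).sort (· ≤ ·)).count j) = J.exponent := by
    funext j
    rw [← Multiset.coe_count, Multiset.sort_eq, MultiIndex.exponent]
  rw [prolongFun, taylorFun_eq_sum, partialDeriv_sum _ _ fun K _ =>
    (contDiff_taylorMonomial_smul _ _ _).contDiffAt]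
  simp_rw [partialDeriv_taylorMonomial_smul_self, hJ, MultiIndex.exponent_injective.eq_iff]
  simp

theorem prolongFun_nil (f : IndepVar p → DepVar q) (x : IndepVar p) :
    prolongFun n f x ⟨0, Sym.nil⟩ = f x := by
  change partialDeriv (Multiset.sort (0 : Multiset (Fin p)) (· ≤ ·)) f x = f x
  rw [Multiset.sort_zero, partialDeriv_nil]

theorem base_prolongFun (f : IndepVar p → DepVar q) (x : IndepVar p) :
    JetSpace.base ((x, prolongFun n f x) : JetSpace p q n) = (x, f x) :=
  Prod.ext rfl (prolongFun_nil f x)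

theorem base_eq_taylorFun (z : JetSpace p q n) : z.base = (z.1, taylorFun z z.1) := by
  rw [← base_prolongFun (n := n), prolongFun_taylorFun]

theorem first_prolongFun (hn : 1 ≤ n) (f : IndepVar p → DepVar q) (x : IndepVar p) (i : Fin p) :
    JetSpace.first hn ((x, prolongFun n f x) : JetSpace p q n) i =
      fderiv ℝ f x (Pi.single i 1) := by
  rw [← partialDeriv_singleton]
  change partialDeriv (Multiset.sort ({i} : Multiset (Fin p)) (· ≤ ·)) f x = _
  rw [Multiset.sort_singleton]

theorem fderiv_taylorFun (hn : 1 ≤ n) (z : JetSpace p q n) (i : Fin p) :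
    fderiv ℝ (taylorFun z) z.1 (Pi.single i 1) = z.first hn i := by
  rw [← first_prolongFun hn, prolongFun_taylorFun]

end Taylor

/-! ### Prolongation of transformations -/

section Germs

variable {ψ ψ₁ ψ₂ : TotalSpace p q → TotalSpace p q} {x : IndepVar p}
  {f f' f₁ f₂ f₁' f₂' : IndepVar p → DepVar q}

/-- The map `y ↦ Ξ (y, f y)` of the independent variables that a transformation `ψ = (Ξ, Φ)`
induces along the graph of `f`. -/
def baseMap (ψ : TotalSpace p q → TotalSpace p q) (f : IndepVar p → DepVar q) (y : IndepVar p) :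
    IndepVar p :=
  (ψ (y, f y)).1

/-- The smooth transformation `ψ` maps the germ at `x` of the graph of the smooth function `f` onto
the germ of the graph of a smooth function, by the inverse function theorem for `baseMap ψ f`. -/
structure IsTransformableAt (ψ : TotalSpace p q → TotalSpace p q) (f : IndepVar p → DepVar q)
    (x : IndepVar p) : Prop where
  contDiffAt_transformation : ContDiffAt ℝ ∞ ψ (x, f x)
  contDiffAt_function : ContDiffAt ℝ ∞ f x
  det_ne_zero : (totalJacobian ψ (x, f x) (fderiv ℝ f x)).det ≠ 0

theorem hasFDerivAt_baseMap (hψ : DifferentiableAt ℝ ψ (x, f x)) (hf : DifferentiableAt ℝ f x) :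
    HasFDerivAt (baseMap ψ f) (totalJacobian ψ (x, f x) (fderiv ℝ f x)) x :=
  HasFDerivAt.comp (g := fun m => (ψ m).1) (f := fun y => (y, f y)) x hψ.fst.hasFDerivAt
    ((hasFDerivAt_id x).prodMk hf.hasFDerivAt)

theorem contDiffAt_graph {m : ℕ∞ω} (hψ : ContDiffAt ℝ m ψ (x, f x)) (hf : ContDiffAt ℝ m f x) :
    ContDiffAt ℝ m (fun y => ψ (y, f y)) x :=
  hψ.comp x (contDiffAt_id.prodMk hf)

namespace IsTransformableAt

theorem contDiffAt_graph (h : IsTransformableAt ψ f x) : ContDiffAt ℝ ∞ (fun y => ψ (y, f y)) x :=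
  VarSym.contDiffAt_graph h.contDiffAt_transformation h.contDiffAt_function

theorem contDiffAt_baseMap (h : IsTransformableAt ψ f x) : ContDiffAt ℝ ∞ (baseMap ψ f) x :=
  h.contDiffAt_graph.fst

theorem hasFDerivAt_baseMap (h : IsTransformableAt ψ f x) :
    HasFDerivAt (baseMap ψ f) (totalJacobian ψ (x, f x) (fderiv ℝ f x)) x :=
  VarSym.hasFDerivAt_baseMap (h.contDiffAt_transformation.differentiableAt (by simp))
    (h.contDiffAt_function.differentiableAt (by simp))

theorem isInvertible_fderiv_baseMap (h : IsTransformableAt ψ f x) :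
    (fderiv ℝ (baseMap ψ f) x).IsInvertible :=
  h.hasFDerivAt_baseMap.fderiv ▸ isInvertible_of_det_ne_zero h.det_ne_zero

theorem exists_isGermTransform (h : IsTransformableAt ψ f x) : ∃ f', IsGermTransform ψ f x f' := by
  obtain ⟨r, hrx, hr, hleft, -⟩ := exists_contDiffAt_local_inverse (by simp)
    h.contDiffAt_baseMap h.isInvertible_fderiv_baseMap
  refine ⟨fun y => (ψ (r y, f (r y))).2, ?_, hleft.mono fun y hy => ?_⟩
  · have hg : ContDiffAt ℝ ∞ (fun y => ψ (y, f y)) (r (baseMap ψ f x)) :=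
      hrx.symm ▸ h.contDiffAt_graph
    exact (hg.comp _ hr).snd
  · rw [baseMap] at hy
    simp only [hy]

theorem congr_sameJet (hn : 1 ≤ n) (h : IsTransformableAt ψ f₁ x) (hf₂ : ContDiffAt ℝ ∞ f₂ x)
    (hf : SameJet ℝ n f₁ f₂ x) : IsTransformableAt ψ f₂ x :=
  ⟨hf.apply_eq ▸ h.contDiffAt_transformation, hf₂,
    hf.apply_eq ▸ hf.fderiv_eq hn ▸ h.det_ne_zero⟩

end IsTransformableAt

namespace IsGermTransform

theorem contDiffAt (h : IsGermTransform ψ f x f') : ContDiffAt ℝ ∞ f' (baseMap ψ f x) := h.1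

theorem eventually_eq (h : IsGermTransform ψ f x f') :
    ∀ᶠ y in 𝓝 x, ψ (y, f y) = (baseMap ψ f y, f' (baseMap ψ f y)) :=
  h.2.mono fun _ hy => Prod.ext rfl hy.symm

theorem apply_eq (h : IsGermTransform ψ f x f') :
    ψ (x, f x) = (baseMap ψ f x, f' (baseMap ψ f x)) :=
  h.eventually_eq.self_of_nhds

theorem congr (h : IsGermTransform ψ₁ f x f') (hψ : ψ₁ =ᶠ[𝓝 (x, f x)] ψ₂)
    (hf : ContinuousAt f x) : IsGermTransform ψ₂ f x f' := by
  refine ⟨hψ.self_of_nhds ▸ h.1, ?_⟩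
  filter_upwards [h.2, (continuousAt_id.prodMk hf).eventually hψ] with y hy hψy
  have hψy : ψ₁ (y, f y) = ψ₂ (y, f y) := hψy
  rw [← hψy, hy]

theorem baseMap_comp_eventuallyEq (h : IsGermTransform ψ₁ f x f') :
    baseMap (ψ₂ ∘ ψ₁) f =ᶠ[𝓝 x] baseMap ψ₂ f' ∘ baseMap ψ₁ f := by
  filter_upwards [h.eventually_eq] with y hy
  simp only [baseMap, Function.comp_apply] at hy ⊢
  rw [← hy]

theorem comp (h₁ : IsGermTransform ψ₁ f x f₁) (h₂ : IsGermTransform ψ₂ f₁ (baseMap ψ₁ f x) f₂)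
    (hc : ContinuousAt (baseMap ψ₁ f) x) : IsGermTransform (ψ₂ ∘ ψ₁) f x f₂ := by
  refine ⟨?_, ?_⟩
  · rw [Function.comp_apply, h₁.apply_eq]
    exact h₂.1
  · filter_upwards [h₁.eventually_eq, hc.eventually h₂.2] with y hy₁ hy₂
    rw [Function.comp_apply, hy₁]
    exact hy₂

theorem sameJet (h₁ : IsGermTransform ψ f₁ x f₁') (h₂ : IsGermTransform ψ f₂ x f₂')
    (hf : SameJet ℝ n f₁ f₂ x) (ht : IsTransformableAt ψ f₁ x) (hf₂ : ContDiffAt ℝ ∞ f₂ x) :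
    SameJet ℝ n f₁' f₂' (baseMap ψ f₁ x) := by
  have hle : (n : ℕ∞ω) ≤ ∞ := mod_cast le_top
  have hψ := ht.contDiffAt_transformation.of_le hle
  have hf₁n := ht.contDiffAt_function.of_le hle
  have hf₂n := hf₂.of_le hle
  have hg₁ : ContDiffAt ℝ n (fun y => ψ (y, f₁ y)) x := contDiffAt_graph hψ hf₁n
  have hg₂ : ContDiffAt ℝ n (fun y => ψ (y, f₂ y)) x := contDiffAt_graph (hf.apply_eq ▸ hψ) hf₂n
  have hb : baseMap ψ f₁ x = baseMap ψ f₂ x := by rw [baseMap, hf.apply_eq, baseMap]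
  have hf₁' : ContDiffAt ℝ n f₁' (baseMap ψ f₁ x) := h₁.contDiffAt.of_le hle
  have hf₂' : ContDiffAt ℝ n f₂' (baseMap ψ f₂ x) := h₂.contDiffAt.of_le hle
  have hgraph : SameJet ℝ n (fun y => ψ (y, f₁ y)) (fun y => ψ (y, f₂ y)) x :=
    SameJet.comp (g₁ := ψ) (g₂ := ψ) (f₁ := fun y => (y, f₁ y)) (f₂ := fun y => (y, f₂ y))
      ((SameJet.refl n _ x).prodMk hf contDiffAt_id contDiffAt_id hf₁n hf₂n) (SameJet.refl _ _ _)
      (contDiffAt_id.prodMk hf₁n) (contDiffAt_id.prodMk hf₂n) hψ hψ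
  have hbase : SameJet ℝ n (baseMap ψ f₁) (baseMap ψ f₂) x :=
    hgraph.clm_comp hg₁ hg₂ (ContinuousLinearMap.fst ℝ _ _)
  have hcomp : SameJet ℝ n (f₁' ∘ baseMap ψ f₁) (f₂' ∘ baseMap ψ f₁) x :=
    (SameJet.of_eventuallyEq h₁.2).trans
      ((hgraph.clm_comp hg₁ hg₂ (ContinuousLinearMap.snd ℝ _ _)).trans
        ((SameJet.of_eventuallyEq h₂.2).symm.trans
          (hbase.symm.comp (SameJet.refl n f₂' _) hg₂.fst hg₁.fst hf₂' hf₂')))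
  obtain ⟨r, hrx, hr, -, hright⟩ := exists_contDiffAt_local_inverse (by simp)
    ht.contDiffAt_baseMap ht.isInvertible_fderiv_baseMap
  exact hcomp.of_comp_right (hf₁'.comp x hg₁.fst) ((hb ▸ hf₂').comp x hg₁.fst) hrx
    (hr.of_le hle) hright

end IsGermTransform

theorem totalJacobian_comp (h₁ : IsGermTransform ψ₁ f x f₁) (ht₁ : IsTransformableAt ψ₁ f x)
    (hψ₂ : ContDiffAt ℝ ∞ ψ₂ (ψ₁ (x, f x))) :
    totalJacobian (ψ₂ ∘ ψ₁) (x, f x) (fderiv ℝ f x) =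
      (totalJacobian ψ₂ (baseMap ψ₁ f x, f₁ (baseMap ψ₁ f x)) (fderiv ℝ f₁ (baseMap ψ₁ f x))).comp
        (totalJacobian ψ₁ (x, f x) (fderiv ℝ f x)) := by
  have hψ : DifferentiableAt ℝ (ψ₂ ∘ ψ₁) (x, f x) :=
    (hψ₂.comp _ ht₁.contDiffAt_transformation).differentiableAt (by simp)
  have hf : DifferentiableAt ℝ f x := ht₁.contDiffAt_function.differentiableAt (by simp)
  rw [h₁.apply_eq] at hψ₂
  refine (hasFDerivAt_baseMap hψ hf).unique
    (HasFDerivAt.congr_of_eventuallyEq ?_ h₁.baseMap_comp_eventuallyEq)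
  exact (hasFDerivAt_baseMap (hψ₂.differentiableAt (by simp))
    (h₁.contDiffAt.differentiableAt (by simp))).comp x ht₁.hasFDerivAt_baseMap

theorem IsTransformableAt.comp (h₁ : IsTransformableAt ψ₁ f x) (hf₁ : IsGermTransform ψ₁ f x f₁)
    (h₂ : IsTransformableAt ψ₂ f₁ (baseMap ψ₁ f x)) : IsTransformableAt (ψ₂ ∘ ψ₁) f x := by
  have hψ₂ : ContDiffAt ℝ ∞ ψ₂ (ψ₁ (x, f x)) := hf₁.apply_eq ▸ h₂.contDiffAt_transformation
  refine ⟨hψ₂.comp _ h₁.contDiffAt_transformation, h₁.contDiffAt_function, ?_⟩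
  rw [totalJacobian_comp hf₁ h₁ hψ₂, det_comp]
  exact mul_ne_zero h₂.det_ne_zero h₁.det_ne_zero

end Germs

section Prolongation

variable {ψ ψ₁ ψ₂ : TotalSpace p q → TotalSpace p q} {x : IndepVar p}
  {f f' : IndepVar p → DepVar q} {z : JetSpace p q n}

/-- The total Jacobian of a transformation as a function on the jet space. -/
noncomputable def jetJacobian (ψ : TotalSpace p q → TotalSpace p q) (z : JetSpace p q n) :
    IndepVar p →L[ℝ] IndepVar p :=
  totalJacobian ψ z.base (fderiv ℝ (taylorFun z) z.1)

theorem sameJet_taylorFun_prolongFun (hf : ContDiffAt ℝ n f x) :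
    SameJet ℝ n (taylorFun ((x, prolongFun n f x) : JetSpace p q n)) f x :=
  (sameJet_iff_prolongFun_eq (contDiff_taylorFun _).contDiffAt hf).2
    (prolongFun_taylorFun ((x, prolongFun n f x) : JetSpace p q n))

theorem exists_eq_prolongFun (z : JetSpace p q n) :
    ∃ (x : IndepVar p) (f : IndepVar p → DepVar q), ContDiff ℝ ∞ f ∧ z = (x, prolongFun n f x) :=
  ⟨z.1, taylorFun z, contDiff_taylorFun z, Prod.ext rfl (prolongFun_taylorFun z).symm⟩

theorem isTransformableAt_taylorFun_prolongFun (hn : 1 ≤ n) (hf : ContDiffAt ℝ ∞ f x) :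
    IsTransformableAt ψ (taylorFun ((x, prolongFun n f x) : JetSpace p q n)) x ↔
      IsTransformableAt ψ f x := by
  have hj := sameJet_taylorFun_prolongFun (n := n) (hf.of_le (mod_cast le_top))
  exact ⟨fun h => h.congr_sameJet hn hf hj,
    fun h => h.congr_sameJet hn (contDiff_taylorFun _).contDiffAt hj.symm⟩

theorem isTransformableAt_taylorFun_iff :
    IsTransformableAt ψ (taylorFun z) z.1 ↔
      ContDiffAt ℝ ∞ ψ z.base ∧ (jetJacobian ψ z).det ≠ 0 := by
  rw [jetJacobian, base_eq_taylorFun]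
  exact ⟨fun h => ⟨h.1, h.3⟩, fun h => ⟨h.1, (contDiff_taylorFun z).contDiffAt, h.2⟩⟩

theorem jetJacobian_prolongFun (hn : 1 ≤ n) (ψ : TotalSpace p q → TotalSpace p q)
    (hf : ContDiffAt ℝ n f x) :
    jetJacobian ψ ((x, prolongFun n f x) : JetSpace p q n) =
      totalJacobian ψ (x, f x) (fderiv ℝ f x) := by
  rw [jetJacobian, base_prolongFun, (sameJet_taylorFun_prolongFun hf).fderiv_eq hn]

theorem jetJacobian_congr (hψ : ψ₁ =ᶠ[𝓝 z.base] ψ₂) : jetJacobian ψ₁ z = jetJacobian ψ₂ z := by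
  have hD : fderiv ℝ (fun m => (ψ₁ m).1) z.base = fderiv ℝ (fun m => (ψ₂ m).1) z.base :=
    (hψ.fun_comp Prod.fst).fderiv_eq
  rw [jetJacobian, jetJacobian, totalJacobian, totalJacobian, hD]

theorem prolongMap_congr (hψ : ψ₁ =ᶠ[𝓝 z.base] ψ₂) : prolongMap n ψ₁ z = prolongMap n ψ₂ z := by
  have hc : ContinuousAt (taylorFun z) z.1 :=
    (contDiff_taylorFun z (m := 0)).continuous.continuousAt
  have hgerm : IsGermTransform ψ₁ (taylorFun z) z.1 = IsGermTransform ψ₂ (taylorFun z) z.1 := by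
    rw [base_eq_taylorFun] at hψ
    exact funext fun f' => propext ⟨fun h => h.congr hψ hc, fun h => h.congr hψ.symm hc⟩
  rw [prolongMap, prolongMap, hψ.self_of_nhds]
  congr! 1 <;> simp only [hgerm]

theorem prolongMap_prolongFun (hn : 1 ≤ n) (h : IsGermTransform ψ f x f')
    (ht : IsTransformableAt ψ f x) :
    prolongMap n ψ (x, prolongFun n f x) = (baseMap ψ f x, prolongFun n f' (baseMap ψ f x)) := by
  have hf := ht.contDiffAt_function
  have hj := sameJet_taylorFun_prolongFun (n := n) (hf.of_le (mod_cast le_top))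
  have hex := ((isTransformableAt_taylorFun_prolongFun hn hf).2 ht).exists_isGermTransform
  have hle : (n : ℕ∞ω) ≤ ∞ := mod_cast le_top
  have hb : baseMap ψ (taylorFun ((x, prolongFun n f x) : JetSpace p q n)) x = baseMap ψ f x := by
    rw [baseMap, hj.apply_eq, baseMap]
  have hjet := h.sameJet hex.choose_spec hj.symm ht (contDiff_taylorFun _).contDiffAt
  have hchoose := hex.choose_spec.contDiffAt
  rw [hb] at hchoose
  rw [prolongMap, dif_pos hex, base_prolongFun]
  exact Prod.ext rfl ((sameJet_iff_prolongFun_eq (h.contDiffAt.of_le hle)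
    (hchoose.of_le hle)).1 hjet).symm

theorem base_prolongMap (hn : 1 ≤ n) (h : IsTransformableAt ψ (taylorFun z) z.1) :
    (prolongMap n ψ z).base = ψ z.base := by
  obtain ⟨x, f, hf, rfl⟩ := exists_eq_prolongFun z
  have ht := (isTransformableAt_taylorFun_prolongFun hn hf.contDiffAt).1 h
  obtain ⟨f', hf'⟩ := ht.exists_isGermTransform
  rw [prolongMap_prolongFun hn hf' ht, base_prolongFun, base_prolongFun, hf'.apply_eq]

theorem prolongMap_comp (hn : 1 ≤ n) (h₁ : IsTransformableAt ψ₁ (taylorFun z) z.1)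
    (h₂ : IsTransformableAt ψ₂ (taylorFun (prolongMap n ψ₁ z)) (prolongMap n ψ₁ z).1) :
    prolongMap n (ψ₂ ∘ ψ₁) z = prolongMap n ψ₂ (prolongMap n ψ₁ z) := by
  obtain ⟨x, f, hf, rfl⟩ := exists_eq_prolongFun z
  have ht₁ := (isTransformableAt_taylorFun_prolongFun hn hf.contDiffAt).1 h₁
  obtain ⟨f₁, hf₁⟩ := ht₁.exists_isGermTransform
  rw [prolongMap_prolongFun hn hf₁ ht₁] at h₂ ⊢
  have ht₂ := (isTransformableAt_taylorFun_prolongFun hn hf₁.contDiffAt).1 h₂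
  obtain ⟨f₂, hf₂⟩ := ht₂.exists_isGermTransform
  rw [prolongMap_prolongFun hn hf₂ ht₂, prolongMap_prolongFun hn
    (hf₁.comp hf₂ ht₁.contDiffAt_baseMap.continuousAt) (ht₁.comp hf₁ ht₂),
    hf₁.baseMap_comp_eventuallyEq.self_of_nhds, Function.comp_apply]

theorem jetJacobian_comp (hn : 1 ≤ n) (h₁ : IsTransformableAt ψ₁ (taylorFun z) z.1)
    (hψ₂ : ContDiffAt ℝ ∞ ψ₂ (ψ₁ z.base)) :
    jetJacobian (ψ₂ ∘ ψ₁) z = (jetJacobian ψ₂ (prolongMap n ψ₁ z)).comp (jetJacobian ψ₁ z) := by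
  obtain ⟨x, f, hf, rfl⟩ := exists_eq_prolongFun z
  have ht₁ := (isTransformableAt_taylorFun_prolongFun hn hf.contDiffAt).1 h₁
  obtain ⟨f₁, hf₁⟩ := ht₁.exists_isGermTransform
  have hle : (n : ℕ∞ω) ≤ ∞ := mod_cast le_top
  rw [base_prolongFun] at hψ₂
  rw [prolongMap_prolongFun hn hf₁ ht₁, jetJacobian_prolongFun hn _ (hf.contDiffAt.of_le hle),
    jetJacobian_prolongFun hn _ (hf.contDiffAt.of_le hle),
    jetJacobian_prolongFun hn _ (hf₁.contDiffAt.of_le hle), totalJacobian_comp hf₁ ht₁ hψ₂]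

end Prolongation

section Identity

variable (z : JetSpace p q n)

theorem jetJacobian_id : jetJacobian id z = ContinuousLinearMap.id ℝ (IndepVar p) := by
  rw [jetJacobian, totalJacobian]
  simp only [id, fderiv_fst]
  rfl

theorem prolongMap_id (hn : 1 ≤ n) : prolongMap n id z = z := by
  obtain ⟨x, f, hf, rfl⟩ := exists_eq_prolongFun z
  refine prolongMap_prolongFun hn ⟨hf.contDiffAt, .of_forall fun y => rfl⟩
    ((isTransformableAt_taylorFun_prolongFun hn hf.contDiffAt).1 ?_)
  refine isTransformableAt_taylorFun_iff.2 ⟨contDiffAt_id, ?_⟩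
  rw [jetJacobian_id]
  simp [ContinuousLinearMap.det]

end Identity

theorem totalDiv_eq_trace (hn : 1 ≤ n) (v : TotalSpace p q → TotalSpace p q) {z : JetSpace p q n}
    (hv : DifferentiableAt ℝ v z.base) :
    totalDiv hn (fun m => (v m).1) z = LinearMap.trace ℝ (IndepVar p) (jetJacobian v z) := by
  rw [LinearMap.trace_eq_matrix_trace ℝ (Pi.basisFun ℝ (Fin p)), Matrix.trace, totalDiv]
  refine Finset.sum_congr rfl fun i _ => ?_
  rw [totalDeriv, ← fderiv_taylorFun, fderiv_apply hv.fst]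
  simp [jetJacobian, totalJacobian]

theorem flow_eq_of_isIntegralCurveOn {M : Set (TotalSpace p q)}
    {v : TotalSpace p q → TotalSpace p q} (hv : ∀ m ∈ M, ContDiffAt ℝ 1 v m) {ε : ℝ}
    {γ : ℝ → TotalSpace p q} (hγM : MapsTo γ (uIcc 0 ε) M)
    (hγ : IsIntegralCurveOn γ (fun _ => v) (uIcc 0 ε)) : flow M v ε (γ 0) = γ ε := by
  have hex : ∃ γ' : ℝ → TotalSpace p q, γ' 0 = γ 0 ∧ MapsTo γ' (uIcc 0 ε) M ∧
      IsIntegralCurveOn γ' (fun _ => v) (uIcc 0 ε) := ⟨γ, rfl, hγM, hγ⟩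
  rw [flow, dif_pos hex]
  obtain ⟨h0, hM, hint⟩ := hex.choose_spec
  exact eqOn_uIcc_of_isIntegralCurveOn hint hγ (fun t ht => hv _ (hM ht))
    (fun t ht => hv _ (hγM ht)) h0 right_mem_uIcc

/-- The Lagrangian `L (pr^(n) ψ · z) det J_ψ (z)` pulled back by the transformation `ψ`. -/
noncomputable def pullbackLagrangian (L : JetSpace p q n → ℝ)
    (ψ : TotalSpace p q → TotalSpace p q) (z : JetSpace p q n) : ℝ :=
  L (prolongMap n ψ z) * (jetJacobian ψ z).det

section SmoothFamily

variable {E : Type*} [NormedAddCommGroup E] [NormedSpace ℝ E]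

theorem contDiffAt_partialDeriv_family (l : List (Fin p)) {F : E × IndepVar p → DepVar q}
    {w : E × IndepVar p} (hF : ContDiffAt ℝ ∞ F w) :
    ContDiffAt ℝ ∞ (fun w => partialDeriv l (fun y => F (w.1, y)) w.2) w := by
  induction l with
  | nil => simpa only [partialDeriv_nil] using hF
  | cons i l ih =>
    have hev : (fun w : E × IndepVar p => partialDeriv (i :: l) (fun y => F (w.1, y)) w.2) =ᶠ[𝓝 w]
        fun w => fderiv ℝ (partialDeriv l fun y => F (w.1, y)) w.2 (Pi.single i 1) := by
      have hF' : ContDiffAt ℝ (l.length + 1 : ℕ) F w := hF.of_le (mod_cast le_top)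
      filter_upwards [hF'.eventually (ENat.natCast_ne_coe_top _)] with w hw
      exact partialDeriv_cons i l
        (ContDiffAt.comp (g := F) w.2 hw (contDiffAt_const.prodMk contDiffAt_id))
    refine ContDiffAt.congr_of_eventuallyEq ?_ hev
    refine (ContDiffAt.fderiv (f := fun w : E × IndepVar p => partialDeriv l fun y => F (w.1, y))
      (n := ∞) ?_ contDiffAt_snd (by simp)).clm_apply contDiffAt_const
    exact ContDiffAt.comp (g := fun w => partialDeriv l (fun y => F (w.1, y)) w.2)
      (f := fun u : (E × IndepVar p) × IndepVar p => (u.1.1, u.2)) (w, w.2) ih (by fun_prop)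

theorem contDiffAt_prolongFun_family {F : E × IndepVar p → DepVar q} {w : E × IndepVar p}
    (hF : ContDiffAt ℝ ∞ F w) :
    ContDiffAt ℝ ∞ (fun w => prolongFun n (fun y => F (w.1, y)) w.2) w :=
  contDiffAt_pi.2 fun _ => contDiffAt_partialDeriv_family _ hF

variable {B : E → TotalSpace p q → TotalSpace p q} {O : Set (E × TotalSpace p q)} {e₀ : E}
  {m : TotalSpace p q} {f : IndepVar p → DepVar q} {x : IndepVar p}

theorem contDiffAt_of_family
    (hB : ContDiffAt ℝ ∞ (fun y : E × TotalSpace p q => B y.1 y.2) (e₀, m)) :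
    ContDiffAt ℝ ∞ (B e₀) m :=
  ContDiffAt.comp (g := fun y : E × TotalSpace p q => B y.1 y.2) m hB
    (contDiffAt_const.prodMk contDiffAt_id)

theorem contDiffAt_totalJacobian
    (hB : ContDiffAt ℝ ∞ (fun y : E × TotalSpace p q => B y.1 y.2) (e₀, m))
    (u : IndepVar p →L[ℝ] DepVar q) :
    ContDiffAt ℝ ∞ (fun w : E × TotalSpace p q × (IndepVar p →L[ℝ] DepVar q) =>
      totalJacobian (B w.1) w.2.1 w.2.2) (e₀, m, u) := by
  have hB' : ContDiffAt ℝ ∞ (fun w : (E × TotalSpace p q × (IndepVar p →L[ℝ] DepVar q)) ×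
      TotalSpace p q => (B w.1.1 w.2).1) ((e₀, m, u), m) :=
    (ContDiffAt.comp (g := fun y : E × TotalSpace p q => B y.1 y.2) ((e₀, m, u), m) hB
      (f := fun w => (w.1.1, w.2)) (by fun_prop)).fst
  refine (ContDiffAt.fderiv (n := ∞) hB' (by fun_prop) (by simp)).clm_comp ?_
  exact ((ContinuousLinearMap.prodₗᵢ (𝕜 := ℝ) (E := IndepVar p) (F := IndepVar p)
    (G := DepVar q) ℝ).contDiff.comp (contDiff_const.prodMk contDiff_snd.snd)).contDiffAt

theorem contDiffAt_totalJacobian_parameter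
    (hB : ContDiffAt ℝ ∞ (fun y : E × TotalSpace p q => B y.1 y.2) (e₀, m))
    (u : IndepVar p →L[ℝ] DepVar q) :
    ContDiffAt ℝ ∞ (fun a => totalJacobian (B a) m u) e₀ :=
  ContDiffAt.comp e₀ (contDiffAt_totalJacobian hB u)
    (contDiffAt_id.prodMk (contDiffAt_const.prodMk contDiffAt_const))

theorem fderiv_totalJacobian_parameter
    (hB : ContDiffAt ℝ ∞ (fun y : E × TotalSpace p q => B y.1 y.2) (e₀, m))
    (u : IndepVar p →L[ℝ] DepVar q) (w : E) :
    fderiv ℝ (fun a => totalJacobian (B a) m u) e₀ w =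
      totalJacobian (fun m' => fderiv ℝ (fun a => B a m') e₀ w) m u := by
  have hB₂ : ContDiffAt ℝ 2 (fun y : E × TotalSpace p q => B y.1 y.2) (e₀, m) :=
    (contDiffAt_infty.1 hB) 2
  have hfst : (fun m' => (fderiv ℝ (fun a => B a m') e₀ w).1) =ᶠ[𝓝 m]
      fun m' => fderiv ℝ (fun a => (B a m').1) e₀ w := by
    have hc : ContinuousAt (fun m' : TotalSpace p q => (e₀, m')) m := by fun_prop
    filter_upwards [hc.eventually (hB₂.eventually (by simp))] with m' hm'
    have hd : DifferentiableAt ℝ (fun a => B a m') e₀ :=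
      (ContDiffAt.comp (g := fun y : E × TotalSpace p q => B y.1 y.2) e₀ hm'
        (contDiffAt_id.prodMk contDiffAt_const)).differentiableAt (by simp)
    rw [fderiv.fst hd]
    rfl
  have hJ : DifferentiableAt ℝ (fun a => totalJacobian (B a) m u) e₀ :=
    (contDiffAt_totalJacobian_parameter hB u).differentiableAt (by simp)
  ext1 y
  have happly : fderiv ℝ (fun a => totalJacobian (B a) m u y) e₀ w =
      fderiv ℝ (fun a => totalJacobian (B a) m u) e₀ w y := by
    simp [fderiv_clm_apply hJ]
  rw [← happly, totalJacobian, hfst.fderiv_eq]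
  exact fderiv_fderiv_comm hB₂.fst w (y, u y)

theorem eventually_isTransformableAt (hO : IsOpen O)
    (hB : ContDiffOn ℝ ∞ (fun y : E × TotalSpace p q => B y.1 y.2) O) (hx : (e₀, x, f x) ∈ O)
    (ht : IsTransformableAt (B e₀) f x) : ∀ᶠ a in 𝓝 e₀, IsTransformableAt (B a) f x := by
  have hc : ContinuousAt (fun a : E => (a, x, f x)) e₀ := by fun_prop
  have hdet : ∀ᶠ a in 𝓝 e₀, (totalJacobian (B a) (x, f x) (fderiv ℝ f x)).det ≠ 0 :=
    (ContinuousLinearMap.continuous_det.continuousAt.comp (contDiffAt_totalJacobian_parameter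
      (hB.contDiffAt (hO.mem_nhds hx)) _).continuousAt).eventually_ne ht.det_ne_zero
  filter_upwards [hc.eventually (hO.mem_nhds hx), hdet] with a ha hdet
  exact ⟨contDiffAt_of_family (hB.contDiffAt (hO.mem_nhds ha)), ht.contDiffAt_function, hdet⟩

variable [CompleteSpace E]

-- The map `(a, y) ↦ (a, Ξ_a (y, f y))` is a local diffeomorphism; composing the `u`-component with
-- its inverse transforms the germ of `f` by all `B a` simultaneously.
theorem exists_isGermTransform_family (hO : IsOpen O)
    (hB : ContDiffOn ℝ ∞ (fun y : E × TotalSpace p q => B y.1 y.2) O) (hf : ContDiff ℝ ∞ f)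
    (hx : (e₀, x, f x) ∈ O) (ht : IsTransformableAt (B e₀) f x) :
    ∃ F : E × IndepVar p → DepVar q, ContDiffAt ℝ ∞ F (e₀, baseMap (B e₀) f x) ∧
      ∀ᶠ a in 𝓝 e₀, IsGermTransform (B a) f x fun y => F (a, y) := by
  let ι : E × IndepVar p → E × TotalSpace p q := fun y => (y.1, (y.2, f y.2))
  have hι : ContDiff ℝ ∞ ι := by fun_prop
  have hO' : IsOpen (ι ⁻¹' O) := hO.preimage hι.continuous
  have hBι : ContDiffOn ℝ ∞ (fun y : E × IndepVar p => B y.1 (y.2, f y.2)) (ι ⁻¹' O) :=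
    hB.comp hι.contDiffOn fun y hy => hy
  let H : E × IndepVar p → E × IndepVar p := fun y => (y.1, baseMap (B y.1) f y.2)
  have hH : ContDiffOn ℝ ∞ H (ι ⁻¹' O) := contDiffOn_fst.prodMk hBι.fst
  have hbase : DifferentiableAt ℝ (fun y : E × IndepVar p => baseMap (B y.1) f y.2) (e₀, x) :=
    (hBι.fst.contDiffAt (hO'.mem_nhds hx)).differentiableAt (by simp)
  have hD : (fderiv ℝ H (e₀, x)).IsInvertible := by
    rw [(hasFDerivAt_fst.prodMk hbase.hasFDerivAt).fderiv]
    exact isInvertible_fst_prod (fderiv_slice_right hbase ▸ ht.isInvertible_fderiv_baseMap)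
  obtain ⟨e, hxe, heO, heH, hsymm⟩ :=
    exists_openPartialHomeomorph_contDiffOn_symm (by simp) hO' hH hx hD
  let F : E × IndepVar p → DepVar q := fun y =>
    (B (e.symm y).1 ((e.symm y).2, f (e.symm y).2)).2
  have hF {y : E × IndepVar p} (hy : y ∈ e.source) : ContDiffAt ℝ ∞ F (H y) :=
    (hBι.comp hsymm fun y hy => heO (e.map_target hy)).snd.contDiffAt
      (e.open_target.mem_nhds (heH ▸ e.map_source hy))
  have hFH {y : E × IndepVar p} (hy : y ∈ e.source) : F (H y) = (B y.1 (y.2, f y.2)).2 := by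
    have hy' : e.symm (H y) = y := heH ▸ e.left_inv hy
    simp only [F, hy']
  refine ⟨F, hF hxe, ?_⟩
  have hcx : ContinuousAt (fun a : E => (a, x)) e₀ := by fun_prop
  filter_upwards [hcx.eventually (e.open_source.mem_nhds hxe)] with a ha
  have hca : ContinuousAt (fun y : IndepVar p => (a, y)) x := by fun_prop
  exact ⟨ContDiffAt.comp (g := F) _ (hF ha) (contDiffAt_const.prodMk contDiffAt_id),
    (hca.eventually (e.open_source.mem_nhds ha)).mono fun y hy => hFH hy⟩

theorem contDiffAt_prolongMap (hn : 1 ≤ n) (hO : IsOpen O)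
    (hB : ContDiffOn ℝ ∞ (fun y : E × TotalSpace p q => B y.1 y.2) O) {z : JetSpace p q n}
    (hz : (e₀, z.base) ∈ O) (ht : IsTransformableAt (B e₀) (taylorFun z) z.1) :
    ContDiffAt ℝ ∞ (fun a => prolongMap n (B a) z) e₀ := by
  obtain ⟨x, f, hf, rfl⟩ := exists_eq_prolongFun z
  rw [base_prolongFun] at hz
  have htf := (isTransformableAt_taylorFun_prolongFun hn hf.contDiffAt).1 ht
  obtain ⟨F, hF, hgerm⟩ := exists_isGermTransform_family hO hB hf hz htf
  have hev : (fun a => prolongMap n (B a) (x, prolongFun n f x)) =ᶠ[𝓝 e₀] fun a =>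
      (baseMap (B a) f x, prolongFun n (fun y => F (a, y)) (baseMap (B a) f x)) := by
    filter_upwards [hgerm, eventually_isTransformableAt hO hB hz htf] with a ha hta
    exact prolongMap_prolongFun hn ha hta
  have hbase : ContDiffAt ℝ ∞ (fun a => baseMap (B a) f x) e₀ :=
    (ContDiffAt.comp (g := fun y : E × TotalSpace p q => B y.1 y.2) e₀
      (hB.contDiffAt (hO.mem_nhds hz)) (contDiffAt_id.prodMk contDiffAt_const)).fst
  refine ContDiffAt.congr_of_eventuallyEq (hbase.prodMk ?_) hev
  exact ContDiffAt.comp (g := fun w : E × IndepVar p => prolongFun n (fun y => F (w.1, y)) w.2) e₀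
    (contDiffAt_prolongFun_family hF) (contDiffAt_id.prodMk hbase)

end SmoothFamily

/-! ### The prolonged group action -/

/-- The coordinate space of a `d`-dimensional Lie group. -/
abbrev Coord (d : ℕ) : Type := EuclideanSpace ℝ (Fin d)

namespace LocalTransformationGroup

variable {d : ℕ} {G : Type*} [TopologicalSpace G] [ChartedSpace (EuclideanSpace ℝ (Fin d)) G]
  [Group G] [LieGroup (𝓡 d) ∞ G] {M : Set (TotalSpace p q)} (A : LocalTransformationGroup d G M)

section CoordinateAction

/-- The action of the group element with coordinates `a`. -/
noncomputable def coordAct (a : Coord d) (m : TotalSpace p q) : TotalSpace p q :=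
  A.act ((chartOne (Coord d) G).symm a) m

/-- The domain of the action in coordinates near the identity. -/
def coordDomain : Set (Coord d × TotalSpace p q) :=
  {y | y.1 ∈ (chartOne (Coord d) G).target ∧ ((chartOne (Coord d) G).symm y.1, y.2) ∈ A.domain}

variable {a : Coord d} {m : TotalSpace p q}

theorem isOpen_coordDomain : IsOpen A.coordDomain := by
  have hc : ContinuousOn (fun y : Coord d × TotalSpace p q =>
      ((chartOne (Coord d) G).symm y.1, y.2)) (Prod.fst ⁻¹' (chartOne (Coord d) G).target) :=
    ((chartOne (Coord d) G).continuousOn_symm.comp continuousOn_fst fun y hy => hy).prodMk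
      continuousOn_snd
  exact hc.isOpen_inter_preimage
    ((chartOne (Coord d) G).open_target.preimage continuous_fst) A.isOpen_domain

theorem coordOne_mem_coordDomain (hm : m ∈ M) : (coordOne (Coord d) G, m) ∈ A.coordDomain :=
  ⟨coordOne_mem_target, chartOne_symm_coordOne (E := Coord d) (G := G) ▸ A.one_mem m hm⟩

theorem contDiffOn_coordAct : ContDiffOn ℝ ∞
    (fun y : Coord d × TotalSpace p q => A.coordAct y.1 y.2) A.coordDomain := by
  rw [← contMDiffOn_iff_contDiffOn]
  have hfst : ContMDiffOn 𝓘(ℝ, Coord d × TotalSpace p q) (𝓡 d) ∞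
      (fun y : Coord d × TotalSpace p q => (chartOne (Coord d) G).symm y.1) A.coordDomain :=
    contMDiffOn_chart_symm.comp contDiffOn_fst.contMDiffOn fun y hy => hy.1
  have hsnd : ContMDiffOn 𝓘(ℝ, Coord d × TotalSpace p q) 𝓘(ℝ, TotalSpace p q) ∞
      (fun y : Coord d × TotalSpace p q => y.2) A.coordDomain := contDiffOn_snd.contMDiffOn
  exact A.smooth_act.comp (hfst.prodMk hsnd) fun y hy => hy.2

theorem contDiffAt_coordAct (h : (a, m) ∈ A.coordDomain) : ContDiffAt ℝ ∞
    (fun y : Coord d × TotalSpace p q => A.coordAct y.1 y.2) (a, m) :=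
  A.contDiffOn_coordAct.contDiffAt (A.isOpen_coordDomain.mem_nhds h)

theorem contDiffAt_coordAct_parameter (h : (a, m) ∈ A.coordDomain) :
    ContDiffAt ℝ ∞ (fun b => A.coordAct b m) a :=
  ContDiffAt.comp (g := fun y : Coord d × TotalSpace p q => A.coordAct y.1 y.2) a
    (A.contDiffAt_coordAct h) (contDiffAt_id.prodMk contDiffAt_const)

theorem coordAct_chartOne {g : G} (hg : g ∈ (chartOne (Coord d) G).source) :
    A.coordAct (chartOne (Coord d) G g) = A.act g :=
  funext fun _ => by rw [coordAct, (chartOne (Coord d) G).left_inv hg]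

theorem coordAct_coordOne : A.coordAct (coordOne (Coord d) G) = A.act 1 :=
  A.coordAct_chartOne (mem_chart_source _ _)

theorem contDiffAt_act {g : G} (h : (g, m) ∈ A.domain) : ContDiffAt ℝ ∞ (A.act g) m := by
  rw [← contMDiffAt_iff_contDiffAt]
  exact ContMDiffAt.comp (g := fun y : G × TotalSpace p q => A.act y.1 y.2) m
    (A.smooth_act.contMDiffAt (A.isOpen_domain.mem_nhds h))
    (contMDiffAt_const.prodMk contMDiffAt_id)

theorem generator_eq (w : GroupLieAlgebra (𝓡 d) G) (hm : m ∈ M) :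
    A.generator w m = fderiv ℝ (fun a => A.coordAct a m) (coordOne (Coord d) G) w := by
  have hact : ContMDiffAt (𝓡 d) 𝓘(ℝ, TotalSpace p q) ∞ (fun g : G => A.act g m) 1 :=
    ContMDiffAt.comp (g := fun y : G × TotalSpace p q => A.act y.1 y.2) 1
      (A.smooth_act.contMDiffAt (A.isOpen_domain.mem_nhds (A.one_mem m hm)))
      (contMDiffAt_id.prodMk contMDiffAt_const)
  rw [generator, (hact.mdifferentiableAt (by simp)).mfderiv, ModelWithCorners.range_eq_univ,
    fderivWithin_univ]
  rfl

theorem contDiffAt_generator (hM : IsOpen M) (w : Coord d) (hm : m ∈ M) :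
    ContDiffAt ℝ ∞ (A.generator w) m := by
  have hswap : ContDiffAt ℝ ∞ (fun y : TotalSpace p q × Coord d => A.coordAct y.2 y.1)
      (m, coordOne (Coord d) G) :=
    ContDiffAt.comp (g := fun y : Coord d × TotalSpace p q => A.coordAct y.1 y.2)
      (m, coordOne (Coord d) G) (A.contDiffAt_coordAct (A.coordOne_mem_coordDomain hm))
      (contDiffAt_snd.prodMk contDiffAt_fst)
  refine ((hswap.fderiv (f := fun m a => A.coordAct a m) (g := fun _ => coordOne (Coord d) G)
    contDiffAt_const (by simp)).clm_apply (contDiffAt_const (c := w))).congr_of_eventuallyEq ?_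
  filter_upwards [hM.mem_nhds hm] with m' hm'
  exact A.generator_eq w hm'

end CoordinateAction

section ProlongedAction

variable {g h : G} {m : TotalSpace p q} {z : JetSpace p q n}

theorem act_one_eventuallyEq (hM : IsOpen M) (hm : m ∈ M) : A.act 1 =ᶠ[𝓝 m] id := by
  filter_upwards [hM.mem_nhds hm] with m' hm' using A.one_act m' hm'

theorem jetJacobian_act_one (hM : IsOpen M) (hz : z ∈ jetSet n M) :
    jetJacobian (A.act 1) z = ContinuousLinearMap.id ℝ (IndepVar p) := by
  rw [jetJacobian_congr (A.act_one_eventuallyEq hM hz), jetJacobian_id]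

theorem prolongMap_act_one (hn : 1 ≤ n) (hM : IsOpen M) (hz : z ∈ jetSet n M) :
    prolongMap n (A.act 1) z = z := by
  rw [prolongMap_congr (A.act_one_eventuallyEq hM hz), prolongMap_id z hn]

theorem eventually_det_jetJacobian_pos (hM : IsOpen M) (hz : z ∈ jetSet n M) :
    ∀ᶠ k in 𝓝 (1 : G), 0 < (jetJacobian (A.act k) z).det := by
  refine eventually_coordOne_iff.1 (Filter.Tendsto.eventually_const_lt
    (v := (jetJacobian (A.coordAct (coordOne (Coord d) G)) z).det) ?_
    (ContinuousLinearMap.continuous_det.continuousAt.comp (contDiffAt_totalJacobian_parameter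
      (A.contDiffAt_coordAct (A.coordOne_mem_coordDomain hz)) _).continuousAt))
  rw [coordAct_coordOne, A.jetJacobian_act_one hM hz]
  simp [ContinuousLinearMap.det]

theorem eventually_act_mul (hm : (h, m) ∈ A.domain) :
    ∀ᶠ k in 𝓝 (1 : G), (k, A.act h m) ∈ A.domain ∧ A.act (k * h) =ᶠ[𝓝 m] A.act k ∘ A.act h := by
  have : IsTopologicalGroup G := topologicalGroup_of_lieGroup (𝓡 d) ∞
  have hact : ContinuousAt (A.act h) m := (A.contDiffAt_act hm).continuousAt
  have hh : ContinuousAt (fun y : G × TotalSpace p q => (h, y.2)) (1, m) := by fun_prop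
  have hk : ContinuousAt (fun y : G × TotalSpace p q => (y.1, A.act h y.2)) (1, m) :=
    continuousAt_fst.prodMk (hact.comp' continuousAt_snd)
  have hkh : ContinuousAt (fun y : G × TotalSpace p q => (y.1 * h, y.2)) (1, m) := by fun_prop
  have hev : ∀ᶠ y in 𝓝 ((1 : G), m), (h, y.2) ∈ A.domain ∧ (y.1, A.act h y.2) ∈ A.domain ∧
      (y.1 * h, y.2) ∈ A.domain :=
    (hh.eventually (A.isOpen_domain.mem_nhds hm)).and
      ((hk.eventually (A.isOpen_domain.mem_nhds (A.one_mem _ (A.act_mem h m hm)))).and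
        (hkh.eventually (A.isOpen_domain.mem_nhds (by simpa using hm))))
  rw [nhds_prod_eq] at hev
  filter_upwards [hev.curry] with k hk
  exact ⟨hk.self_of_nhds.2.1, hk.mono fun m' hm' => (A.act_act k h m' hm'.1 hm'.2.1 hm'.2.2).symm⟩

/-- The pairs of a group element and an `n`-jet such that the element can be prolonged to the jet,
without the connectedness that `prolongedDomain` imposes. -/
def jetDomain (n : ℕ) : Set (G × JetSpace p q n) :=
  {y | (y.1, y.2.base) ∈ A.domain ∧ (jetJacobian (A.act y.1) y.2).det ≠ 0}

variable {A}

theorem isTransformableAt_of_mem_jetDomain (h : (g, z) ∈ A.jetDomain n) :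
    IsTransformableAt (A.act g) (taylorFun z) z.1 :=
  isTransformableAt_taylorFun_iff.2 ⟨A.contDiffAt_act h.1, h.2⟩

theorem prolongMap_mem_jetSet (hn : 1 ≤ n) (h : (g, z) ∈ A.jetDomain n) :
    prolongMap n (A.act g) z ∈ jetSet n M := by
  rw [jetSet, mem_ofPred_eq, base_prolongMap hn (isTransformableAt_of_mem_jetDomain h)]
  exact A.act_mem _ _ h.1

variable (A)

theorem one_mem_jetDomain (hM : IsOpen M) (hz : z ∈ jetSet n M) : ((1 : G), z) ∈ A.jetDomain n :=
  ⟨A.one_mem _ hz, (A.eventually_det_jetJacobian_pos hM hz).self_of_nhds.ne'⟩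

theorem eventually_mem_jetDomain (hM : IsOpen M) (hz : z ∈ jetSet n M) :
    ∀ᶠ k in 𝓝 (1 : G), (k, z) ∈ A.jetDomain n := by
  have hc : ContinuousAt (fun k : G => (k, z.base)) 1 := by fun_prop
  filter_upwards [hc.eventually (A.isOpen_domain.mem_nhds (A.one_mem _ hz)),
    A.eventually_det_jetJacobian_pos hM hz] with k hk hdet
  exact ⟨hk, hdet.ne'⟩

variable {A}

theorem eventually_prolongMap_mul (hn : 1 ≤ n) (hM : IsOpen M) (hz : (h, z) ∈ A.jetDomain n) :
    ∀ᶠ k in 𝓝 (1 : G),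
      prolongMap n (A.act (k * h)) z = prolongMap n (A.act k) (prolongMap n (A.act h) z) ∧
      jetJacobian (A.act (k * h)) z =
        (jetJacobian (A.act k) (prolongMap n (A.act h) z)).comp (jetJacobian (A.act h) z) := by
  have hht := isTransformableAt_of_mem_jetDomain hz
  filter_upwards [A.eventually_mem_jetDomain hM (prolongMap_mem_jetSet hn hz),
    A.eventually_act_mul hz.1] with k hk ⟨hkh, hmul⟩
  rw [prolongMap_congr hmul, jetJacobian_congr hmul]
  exact ⟨prolongMap_comp hn hht (isTransformableAt_of_mem_jetDomain hk),
    jetJacobian_comp hn hht (A.contDiffAt_act hkh)⟩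

end ProlongedAction

section Generators

variable {m : TotalSpace p q} {z : JetSpace p q n}

theorem fderiv_coordAct_rightTranslation {b : Coord d} (h : (b, m) ∈ A.coordDomain)
    (w : Coord d) : fderiv ℝ (fun a => A.coordAct a m) b (rightTranslation (Coord d) G b w) =
      A.generator w (A.coordAct b m) := by
  have hmul : ∀ᶠ a in 𝓝 (coordOne (Coord d) G),
      A.coordAct (coordMul (Coord d) G (a, b)) m = A.coordAct a (A.coordAct b m) := by
    filter_upwards [eventually_chartOne_symm_coordMul h.1,
      eventually_coordOne_iff.2 (A.eventually_act_mul h.2)] with a ha hact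
    rw [coordAct, ha, hact.2.self_of_nhds]
    rfl
  have hderiv := fderiv_comp_rightTranslation h.1
    ((A.contDiffAt_coordAct_parameter h).differentiableAt (by simp)) hmul
  exact (DFunLike.congr_fun hderiv w).trans (A.generator_eq w (A.act_mem _ _ h.2)).symm

theorem exists_curve_flow_eq (hM : IsOpen M) (w : Coord d) (hm : m ∈ M) :
    ∃ c : ℝ → Coord d, c 0 = coordOne (Coord d) G ∧ HasDerivAt c w 0 ∧
      ∀ᶠ t in 𝓝 0, flow M (A.generator w) t =ᶠ[𝓝 m] A.coordAct (c t) := by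
  obtain ⟨c, hc0, hc⟩ := exists_hasDerivAt_rightTranslation (G := G) w
  have hcw : HasDerivAt c w 0 := by
    simpa [hc0, rightTranslation_coordOne] using hc.self_of_nhds
  refine ⟨c, hc0, hcw, ?_⟩
  have hcont : ContinuousAt (fun y : ℝ × TotalSpace p q => (c y.1, y.2)) (0, m) :=
    (ContinuousAt.comp (f := Prod.fst) (x := (0, m)) hcw.continuousAt continuousAt_fst).prodMk
      continuousAt_snd
  have hdomain : ∀ᶠ y : ℝ × TotalSpace p q in 𝓝 (0, m), (c y.1, y.2) ∈ A.coordDomain :=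
    hcont.eventually (A.isOpen_coordDomain.mem_nhds
      (by simpa only [hc0] using A.coordOne_mem_coordDomain hm))
  obtain ⟨δ, hδ, hball⟩ :=
    Metric.eventually_nhds_iff_ball.1 ((continuousAt_fst.eventually hc).and hdomain)
  rw [← ball_prod_same] at hball
  filter_upwards [Metric.ball_mem_nhds 0 hδ] with t ht
  filter_upwards [Metric.ball_mem_nhds m hδ, hM.mem_nhds hm] with m' hm' hm'M
  have hsub : uIcc 0 t ⊆ Metric.ball (0 : ℝ) δ :=
    (convex_ball (0 : ℝ) δ).ordConnected.uIcc_subset (Metric.mem_ball_self hδ) ht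
  have hmaps : MapsTo (fun s => A.coordAct (c s) m') (uIcc 0 t) M := fun s hs =>
    A.act_mem _ _ (hball (s, m') ⟨hsub hs, hm'⟩).2.2
  have hcurve : IsIntegralCurveOn (fun s => A.coordAct (c s) m') (fun _ => A.generator w)
      (uIcc 0 t) := by
    intro s hs
    obtain ⟨hcs, hds⟩ := hball (s, m') ⟨hsub hs, hm'⟩
    have hderiv := ((A.contDiffAt_coordAct_parameter hds).differentiableAt
      (by simp)).hasFDerivAt.comp_hasDerivAt s hcs
    rw [A.fderiv_coordAct_rightTranslation hds w] at hderiv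
    exact hderiv.hasDerivWithinAt
  have hflow := flow_eq_of_isIntegralCurveOn
    (fun m hm => (A.contDiffAt_generator hM w hm).of_le (by simp)) hmaps hcurve
  rwa [hc0, A.coordAct_coordOne, A.one_act m' hm'M] at hflow

theorem contDiffAt_prolongMap_coordAct (hn : 1 ≤ n) {b : Coord d}
    (hb : b ∈ (chartOne (Coord d) G).target)
    (hz : ((chartOne (Coord d) G).symm b, z) ∈ A.jetDomain n) :
    ContDiffAt ℝ ∞ (fun a => prolongMap n (A.coordAct a) z) b :=
  contDiffAt_prolongMap hn A.isOpen_coordDomain A.contDiffOn_coordAct ⟨hb, hz.1⟩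
    (isTransformableAt_of_mem_jetDomain hz)

theorem prolongField_generator (hn : 1 ≤ n) (hM : IsOpen M) (w : Coord d)
    (hz : z ∈ jetSet n M) : prolongField n M (A.generator w) z =
      fderiv ℝ (fun a => prolongMap n (A.coordAct a) z) (coordOne (Coord d) G) w := by
  obtain ⟨c, hc0, hc, hflow⟩ := A.exists_curve_flow_eq hM w hz
  have hev : (fun t => prolongMap n (flow M (A.generator w) t) z) =ᶠ[𝓝 0]
      fun t => prolongMap n (A.coordAct (c t)) z :=
    hflow.mono fun t ht => prolongMap_congr ht
  have hdiff : DifferentiableAt ℝ (fun a => prolongMap n (A.coordAct a) z)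
      (coordOne (Coord d) G) := by
    refine (A.contDiffAt_prolongMap_coordAct hn coordOne_mem_target ?_).differentiableAt (by simp)
    rw [chartOne_symm_coordOne]
    exact A.one_mem_jetDomain hM hz
  rw [← hc0] at hdiff ⊢
  rw [prolongField, hev.deriv_eq]
  exact (hdiff.hasFDerivAt.comp_hasDerivAt 0 hc).deriv

end Generators

/-! ### Invariance of the Lagrangian -/

variable {A} {L : JetSpace p q n → ℝ} {g h : G} {z : JetSpace p q n}

theorem eventually_pullbackLagrangian_mul (hn : 1 ≤ n) (hM : IsOpen M) (L : JetSpace p q n → ℝ)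
    (hz : (h, z) ∈ A.jetDomain n) :
    ∀ᶠ k in 𝓝 (1 : G), pullbackLagrangian L (A.act (k * h)) z =
      pullbackLagrangian L (A.act k) (prolongMap n (A.act h) z) *
        (jetJacobian (A.act h) z).det := by
  filter_upwards [eventually_prolongMap_mul hn hM hz] with k ⟨hmap, hjac⟩
  rw [pullbackLagrangian, pullbackLagrangian, hmap, hjac, det_comp, mul_assoc]

theorem pullbackLagrangian_act_one (hn : 1 ≤ n) (hM : IsOpen M) (hz : z ∈ jetSet n M) :
    pullbackLagrangian L (A.act 1) z = L z := by
  rw [pullbackLagrangian, A.prolongMap_act_one hn hM hz, A.jetJacobian_act_one hM hz]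
  simp [ContinuousLinearMap.det]

section LocalInvariance

variable (A L) in
/-- The group elements near the identity, how near depending on the jet, preserve `L dx`. -/
def LocallyInvariant : Prop :=
  ∀ z ∈ jetSet n M, ∀ᶠ g in 𝓝 (1 : G), pullbackLagrangian L (A.act g) z = L z

theorem LocallyInvariant.pullbackLagrangian_eq (hA : A.LocallyInvariant L) (hn : 1 ≤ n)
    (hM : IsOpen M) (hz : z ∈ jetSet n M)
    (hg : g ∈ A.prolongedDomain z.base (fderiv ℝ (taylorFun z) z.1)) :
    pullbackLagrangian L (A.act g) z = L z ∧ 0 < (jetJacobian (A.act g) z).det := by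
  have : IsTopologicalGroup G := topologicalGroup_of_lieGroup (𝓡 d) ∞
  let F (k : G) : ℝ × SignType :=
    (pullbackLagrangian L (A.act k) z, SignType.sign (jetJacobian (A.act k) z).det)
  have hF : F g = F 1 := by
    refine eq_of_isPreconnected_of_eventually_mul
      (S := connectedComponentIn {k | (k, z) ∈ A.jetDomain n} 1)
      isPreconnected_connectedComponentIn (fun h hh => ?_) hg
      (mem_connectedComponentIn (A.one_mem_jetDomain hM hz))
    have hhz : (h, z) ∈ A.jetDomain n :=
      connectedComponentIn_subset {k | (k, z) ∈ A.jetDomain n} 1 hh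
    have hz' := prolongMap_mem_jetSet hn hhz
    filter_upwards [eventually_pullbackLagrangian_mul hn hM L hhz,
      eventually_prolongMap_mul hn hM hhz, hA _ hz',
      A.eventually_det_jetJacobian_pos hM hz'] with k hpull hmul hinv hpos
    refine Prod.ext (hpull.trans (by rw [hinv]; rfl)) ?_
    simp only [F, hmul.2, det_comp, sign_mul, sign_pos hpos, one_mul]
  have hone := (A.eventually_det_jetJacobian_pos hM hz).self_of_nhds
  refine ⟨(congrArg Prod.fst hF).trans (pullbackLagrangian_act_one hn hM hz), ?_⟩
  exact sign_eq_one_iff.1 ((congrArg Prod.snd hF).trans (sign_pos hone))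

end LocalInvariance

section InfinitesimalInvariance

theorem contDiffAt_det_jetJacobian_coordAct {b : Coord d}
    (hz : (b, z.base) ∈ A.coordDomain) :
    ContDiffAt ℝ ∞ (fun a => (jetJacobian (A.coordAct a) z).det) b :=
  contDiff_det.contDiffAt.comp b (contDiffAt_totalJacobian_parameter (A.contDiffAt_coordAct hz) _)

theorem differentiableAt_pullbackLagrangian (hn : 1 ≤ n) (hM : IsOpen M)
    (hL : DifferentiableOn ℝ L (jetSet n M)) {b : Coord d}
    (hb : b ∈ (chartOne (Coord d) G).target)
    (hz : ((chartOne (Coord d) G).symm b, z) ∈ A.jetDomain n) :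
    DifferentiableAt ℝ (fun a => pullbackLagrangian L (A.coordAct a) z) b := by
  have hLz : DifferentiableAt ℝ L (prolongMap n (A.coordAct b) z) :=
    hL.differentiableAt ((isOpen_jetSet hM).mem_nhds (prolongMap_mem_jetSet hn hz))
  exact (hLz.comp b ((A.contDiffAt_prolongMap_coordAct hn hb hz).differentiableAt (by simp))).mul
    ((contDiffAt_det_jetJacobian_coordAct ⟨hb, hz.1⟩).differentiableAt (by simp))

variable (A) in
theorem fderiv_det_jetJacobian (hn : 1 ≤ n) (hM : IsOpen M) (w : Coord d)
    (hz : z ∈ jetSet n M) :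
    fderiv ℝ (fun a => (jetJacobian (A.coordAct a) z).det) (coordOne (Coord d) G) w =
      totalDiv hn (fun m => (A.generator w m).1) z := by
  have hact := A.contDiffAt_coordAct (A.coordOne_mem_coordDomain hz)
  have hone : jetJacobian (A.coordAct (coordOne (Coord d) G)) z = ContinuousLinearMap.id ℝ _ := by
    rw [coordAct_coordOne, A.jetJacobian_act_one hM hz]
  have hdet : HasFDerivAt (fun D : IndepVar p →L[ℝ] IndepVar p => D.det)
      (fderiv ℝ (fun D : IndepVar p →L[ℝ] IndepVar p => D.det) (ContinuousLinearMap.id ℝ _))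
      (jetJacobian (A.coordAct (coordOne (Coord d) G)) z) := by
    rw [hone]
    exact (contDiff_det.differentiable one_ne_zero _).hasFDerivAt
  have hgenerator : A.generator w =ᶠ[𝓝 z.base]
      fun m => fderiv ℝ (fun a => A.coordAct a m) (coordOne (Coord d) G) w := by
    filter_upwards [hM.mem_nhds hz] with m hm using A.generator_eq w hm
  rw [totalDiv_eq_trace hn _ ((A.contDiffAt_generator hM w hz).differentiableAt (by simp)),
    jetJacobian_congr hgenerator, jetJacobian, ← fderiv_totalJacobian_parameter hact,
    ← fderiv_det_id]
  exact DFunLike.congr_fun (hdet.comp (coordOne (Coord d) G)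
    ((contDiffAt_totalJacobian_parameter hact _).differentiableAt
      (by simp)).hasFDerivAt).fderiv w

variable (A) in
theorem fderiv_pullbackLagrangian (hn : 1 ≤ n) (hM : IsOpen M) (w : Coord d)
    (hz : z ∈ jetSet n M) (hL : DifferentiableAt ℝ L z) :
    fderiv ℝ (fun a => pullbackLagrangian L (A.coordAct a) z) (coordOne (Coord d) G) w =
      fderiv ℝ L z (prolongField n M (A.generator w) z) +
        L z * totalDiv hn (fun m => (A.generator w m).1) z := by
  have hjet : ((chartOne (Coord d) G).symm (coordOne (Coord d) G), z) ∈ A.jetDomain n := by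
    rw [chartOne_symm_coordOne]
    exact A.one_mem_jetDomain hM hz
  have hmap : prolongMap n (A.coordAct (coordOne (Coord d) G)) z = z := by
    rw [coordAct_coordOne, A.prolongMap_act_one hn hM hz]
  have hdet : (jetJacobian (A.coordAct (coordOne (Coord d) G)) z).det = 1 := by
    rw [coordAct_coordOne, A.jetJacobian_act_one hM hz]
    simp [ContinuousLinearMap.det]
  have hmap' := ((A.contDiffAt_prolongMap_coordAct hn coordOne_mem_target hjet).differentiableAt
    (by simp)).hasFDerivAt
  have hdet' := ((contDiffAt_det_jetJacobian_coordAct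
    (A.coordOne_mem_coordDomain hz)).differentiableAt (by simp)).hasFDerivAt
  have hL' : HasFDerivAt L (fderiv ℝ L z) (prolongMap n (A.coordAct (coordOne (Coord d) G)) z) :=
    hmap.symm ▸ hL.hasFDerivAt
  refine (DFunLike.congr_fun ((hL'.comp (coordOne (Coord d) G) hmap').mul hdet').fderiv w).trans ?_
  rw [prolongField_generator A hn hM w hz, ← fderiv_det_jetJacobian A hn hM w hz]
  simp [hmap, hdet, add_comm]

theorem eventually_fderiv_pullbackLagrangian_eq_zero (hn : 1 ≤ n) (hM : IsOpen M)
    (hL : DifferentiableOn ℝ L (jetSet n M)) (h : ∀ z ∈ jetSet n M,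
      fderiv ℝ (fun a => pullbackLagrangian L (A.coordAct a) z) (coordOne (Coord d) G) = 0)
    (hz : z ∈ jetSet n M) : ∀ᶠ b in 𝓝 (coordOne (Coord d) G),
      fderiv ℝ (fun a => pullbackLagrangian L (A.coordAct a) z) b = 0 := by
  filter_upwards [(chartOne (Coord d) G).open_target.mem_nhds coordOne_mem_target,
    eventually_coordOne_iff.2 (A.eventually_mem_jetDomain hM hz),
    eventually_isInvertible_rightTranslation] with b hb hbz ⟨D, hD⟩
  have hmul : ∀ᶠ a in 𝓝 (coordOne (Coord d) G),
      pullbackLagrangian L (A.coordAct (coordMul (Coord d) G (a, b))) z =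
        pullbackLagrangian L (A.coordAct a) (prolongMap n (A.coordAct b) z) *
          (jetJacobian (A.coordAct b) z).det := by
    filter_upwards [eventually_chartOne_symm_coordMul hb,
      eventually_coordOne_iff.2 (eventually_pullbackLagrangian_mul hn hM L hbz)] with a ha hact
    exact (congrArg (fun g => pullbackLagrangian L (A.act g) z) ha).trans hact
  have hderiv := fderiv_comp_rightTranslation hb
    (differentiableAt_pullbackLagrangian hn hM hL hb hbz) hmul
  have hmem := prolongMap_mem_jetSet hn hbz
  have hdiff : DifferentiableAt ℝ
      (fun a => pullbackLagrangian L (A.coordAct a) (prolongMap n (A.coordAct b) z))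
      (coordOne (Coord d) G) :=
    differentiableAt_pullbackLagrangian hn hM hL coordOne_mem_target
      (chartOne_symm_coordOne (E := Coord d) (G := G) ▸ A.one_mem_jetDomain hM hmem)
  rw [fderiv_mul_const' hdiff, h (prolongMap n (A.coordAct b) z) hmem, smul_zero, ← hD] at hderiv
  ext v
  simpa using DFunLike.congr_fun hderiv (D.symm v)

theorem locallyInvariant_iff (hn : 1 ≤ n) (hM : IsOpen M)
    (hL : DifferentiableOn ℝ L (jetSet n M)) :
    A.LocallyInvariant L ↔ ∀ v ∈ A.generators, ∀ z ∈ jetSet n M,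
      fderiv ℝ L z (prolongField n M v z) + L z * totalDiv hn (fun m => (v m).1) z = 0 := by
  have hderiv (w : Coord d) (z : JetSpace p q n) (hz : z ∈ jetSet n M) :=
    fderiv_pullbackLagrangian A hn hM w hz (hL.differentiableAt ((isOpen_jetSet hM).mem_nhds hz))
  constructor
  · rintro h _ ⟨w, rfl⟩ z hz
    have hconst : (fun a => pullbackLagrangian L (A.coordAct a) z) =ᶠ[𝓝 (coordOne (Coord d) G)]
        fun _ => L z := eventually_coordOne_iff.2 (h z hz)
    rw [← hderiv w z hz, hconst.fderiv_eq, fderiv_fun_const]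
    rfl
  · intro h z hz
    have hdiff : ∀ᶠ b in 𝓝 (coordOne (Coord d) G),
        DifferentiableAt ℝ (fun a => pullbackLagrangian L (A.coordAct a) z) b := by
      filter_upwards [(chartOne (Coord d) G).open_target.mem_nhds coordOne_mem_target,
        eventually_coordOne_iff.2 (A.eventually_mem_jetDomain hM hz)] with b hb hbz
      exact differentiableAt_pullbackLagrangian hn hM hL hb hbz
    have hzero := eventually_fderiv_pullbackLagrangian_eq_zero hn hM hL
      (fun z hz => ContinuousLinearMap.ext fun w =>
        (hderiv w z hz).trans (h _ (mem_range_self w) z hz)) hz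
    refine eventually_coordOne_iff.1
      ((eventually_eq_of_eventually_fderiv_eq_zero hdiff hzero).mono fun b hb => hb.trans ?_)
    rw [coordAct_coordOne, pullbackLagrangian_act_one hn hM hz]

end InfinitesimalInvariance

section ChangeOfVariables

variable {Ω Ω' : Set (IndepVar p)} {f f' : IndepVar p → DepVar q} {x : IndepVar p}

theorem continuousOn_lagrangian_prolongFun (hL : ContinuousOn L (jetSet n M)) (hΩ : IsOpen Ω)
    (hf : ContDiffOn ℝ ∞ f Ω) (hfM : ∀ x ∈ Ω, (x, f x) ∈ M) :
    ContinuousOn (fun x => L (x, prolongFun n f x)) Ω := by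
  refine hL.comp (fun x hx => ?_) fun x hx => ?_
  · exact (continuousAt_id.prodMk (contDiffAt_prolongFun
      (hf.contDiffAt (hΩ.mem_nhds hx))).continuousAt).continuousWithinAt
  · rw [jetSet, mem_ofPred_eq, base_prolongFun]
    exact hfM x hx

namespace IsTransform

theorem mem_domain (h : A.IsTransform g Ω f Ω' f') (hx : x ∈ Ω) : (g, (x, f x)) ∈ A.domain :=
  (connectedComponentIn_subset _ _ (h.1 x hx)).1

theorem mem (h : A.IsTransform g Ω f Ω' f') (hx : x ∈ Ω) : (x, f x) ∈ M :=
  (A.domain_subset (h.mem_domain hx)).2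

theorem isTransformableAt (h : A.IsTransform g Ω f Ω' f') (hΩ : IsOpen Ω)
    (hf : ContDiffOn ℝ ∞ f Ω) (hx : x ∈ Ω) : IsTransformableAt (A.act g) f x :=
  ⟨A.contDiffAt_act (h.mem_domain hx), hf.contDiffAt (hΩ.mem_nhds hx),
    (connectedComponentIn_subset _ _ (h.1 x hx)).2⟩

theorem baseMap_mem (h : A.IsTransform g Ω f Ω' f') (hx : x ∈ Ω) :
    baseMap (A.act g) f x ∈ Ω' := by
  obtain ⟨y, hy, hyx⟩ : A.act g (x, f x) ∈ Ω'.graphOn f' :=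
    h.2.2.2 ▸ mem_image_of_mem _ (mem_image_of_mem _ hx)
  rw [baseMap, ← hyx]
  exact hy

theorem act_eq (h : A.IsTransform g Ω f Ω' f') (hx : x ∈ Ω) :
    A.act g (x, f x) = (baseMap (A.act g) f x, f' (baseMap (A.act g) f x)) := by
  obtain ⟨y, -, hyx⟩ : A.act g (x, f x) ∈ Ω'.graphOn f' :=
    h.2.2.2 ▸ mem_image_of_mem _ (mem_image_of_mem _ hx)
  rw [baseMap, ← hyx]

theorem image_baseMap (h : A.IsTransform g Ω f Ω' f') : baseMap (A.act g) f '' Ω = Ω' := by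
  refine (image_subset_iff.2 fun x hx => h.baseMap_mem hx).antisymm fun y hy => ?_
  obtain ⟨_, ⟨x, hx, rfl⟩, hxy⟩ : (y, f' y) ∈ A.act g '' Ω.graphOn f :=
    h.2.2.2 ▸ mem_image_of_mem _ hy
  exact ⟨x, hx, congrArg Prod.fst hxy⟩

theorem injOn_baseMap (h : A.IsTransform g Ω f Ω' f') : InjOn (baseMap (A.act g) f) Ω := by
  intro x hx y hy hxy
  have hinv {x : IndepVar p} (hx : x ∈ Ω) : A.act g⁻¹ (A.act g (x, f x)) = (x, f x) := by
    rw [A.act_act g⁻¹ g _ (h.mem_domain hx) (A.inv_mem _ _ (h.mem_domain hx))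
      (by simpa using A.one_mem _ (h.mem hx)), inv_mul_cancel, A.one_act _ (h.mem hx)]
  have hact : A.act g (x, f x) = A.act g (y, f y) := by rw [h.act_eq hx, h.act_eq hy, hxy]
  exact congrArg Prod.fst ((hinv hx).symm.trans (hact ▸ hinv hy))

theorem isGermTransform (h : A.IsTransform g Ω f Ω' f') (hΩ : IsOpen Ω) (hx : x ∈ Ω) :
    IsGermTransform (A.act g) f x f' := by
  refine ⟨h.2.2.1.contDiffAt (h.2.1.mem_nhds (h.baseMap_mem hx)), ?_⟩
  filter_upwards [hΩ.mem_nhds hx] with y hy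
  exact (congrArg Prod.snd (h.act_eq hy)).symm

theorem pullbackLagrangian_prolongFun (h : A.IsTransform g Ω f Ω' f') (hn : 1 ≤ n)
    (hΩ : IsOpen Ω) (hf : ContDiffOn ℝ ∞ f Ω) (hx : x ∈ Ω) (L : JetSpace p q n → ℝ) :
    pullbackLagrangian L (A.act g) (x, prolongFun n f x) =
      L (baseMap (A.act g) f x, prolongFun n f' (baseMap (A.act g) f x)) *
        (totalJacobian (A.act g) (x, f x) (fderiv ℝ f x)).det := by
  have ht := h.isTransformableAt hΩ hf hx
  rw [pullbackLagrangian, prolongMap_prolongFun hn (h.isGermTransform hΩ hx) ht,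
    jetJacobian_prolongFun hn _ (ht.contDiffAt_function.of_le (mod_cast le_top))]

theorem integrableOn_iff_and_setIntegral_eq (h : A.IsTransform g Ω f Ω' f') (hn : 1 ≤ n)
    (hΩ : IsOpen Ω) (hf : ContDiffOn ℝ ∞ f Ω)
    (hpos : ∀ x ∈ Ω, 0 < (totalJacobian (A.act g) (x, f x) (fderiv ℝ f x)).det)
    (L : JetSpace p q n → ℝ) :
    (IntegrableOn (fun x => L (x, prolongFun n f' x)) Ω' ↔
      IntegrableOn (fun x => pullbackLagrangian L (A.act g) (x, prolongFun n f x)) Ω) ∧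
    ∫ x in Ω', L (x, prolongFun n f' x) =
      ∫ x in Ω, pullbackLagrangian L (A.act g) (x, prolongFun n f x) := by
  have hderiv (x : IndepVar p) (hx : x ∈ Ω) :=
    (h.isTransformableAt hΩ hf hx).hasFDerivAt_baseMap.hasFDerivWithinAt (s := Ω)
  have hpull : EqOn (fun x => |(totalJacobian (A.act g) (x, f x) (fderiv ℝ f x)).det| •
      L (baseMap (A.act g) f x, prolongFun n f' (baseMap (A.act g) f x)))
      (fun x => pullbackLagrangian L (A.act g) (x, prolongFun n f x)) Ω := fun x hx => by
    simp only [h.pullbackLagrangian_prolongFun hn hΩ hf hx, abs_of_pos (hpos x hx), smul_eq_mul,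
      mul_comm]
  rw [← h.image_baseMap, integrableOn_image_iff_integrableOn_abs_det_fderiv_smul volume
    hΩ.measurableSet hderiv h.injOn_baseMap, integral_image_eq_integral_abs_det_fderiv_smul volume
    hΩ.measurableSet hderiv h.injOn_baseMap]
  exact ⟨integrableOn_congr_fun hpull hΩ.measurableSet,
    setIntegral_congr_fun hΩ.measurableSet hpull⟩

theorem continuousOn_pullbackLagrangian (h : A.IsTransform g Ω f Ω' f') (hn : 1 ≤ n)
    (hΩ : IsOpen Ω) (hf : ContDiffOn ℝ ∞ f Ω) (hL : ContinuousOn L (jetSet n M)) :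
    ContinuousOn (fun x => pullbackLagrangian L (A.act g) (x, prolongFun n f x)) Ω := by
  have ht (x : IndepVar p) (hx : x ∈ Ω) := h.isTransformableAt hΩ hf hx
  have hbase : ContDiffOn ℝ ∞ (baseMap (A.act g) f) Ω :=
    fun x hx => (ht x hx).contDiffAt_baseMap.contDiffWithinAt
  have hLf' : ContinuousOn (fun x => L (x, prolongFun n f' x)) Ω' := by
    refine continuousOn_lagrangian_prolongFun hL h.2.1 h.2.2.1 ?_
    rw [← h.image_baseMap, forall_mem_image]
    intro x hx
    rw [← h.act_eq hx]
    exact A.act_mem _ _ (h.mem_domain hx)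
  refine ((hLf'.comp hbase.continuousOn fun x hx => h.baseMap_mem hx).mul
    (ContinuousLinearMap.continuous_det.comp_continuousOn
      (hbase.continuousOn_fderiv_of_isOpen hΩ (by simp)))).congr fun x hx => ?_
  rw [h.pullbackLagrangian_prolongFun hn hΩ hf hx, ← (ht x hx).hasFDerivAt_baseMap.fderiv]
  rfl

end IsTransform

theorem LocallyInvariant.isVariationalSymmetry (hA : A.LocallyInvariant L) (hn : 1 ≤ n)
    (hM : IsOpen M) (Ω₀ : Set (IndepVar p)) : A.IsVariationalSymmetry Ω₀ L := by
  intro Ω f g Ω' f' hΩ _ _ hf _ h _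
  have hinv (x : IndepVar p) (hx : x ∈ Ω) :
      pullbackLagrangian L (A.act g) (x, prolongFun n f x) = L (x, prolongFun n f x) ∧
        0 < (totalJacobian (A.act g) (x, f x) (fderiv ℝ f x)).det := by
    have hfx : ContDiffAt ℝ n f x :=
      (hf.contDiffAt (hΩ.mem_nhds hx)).of_le (mod_cast le_top)
    rw [← jetJacobian_prolongFun hn _ hfx]
    refine hA.pullbackLagrangian_eq hn hM ?_ ?_
    · rw [jetSet, mem_ofPred_eq, base_prolongFun]
      exact h.mem hx
    · rw [base_prolongFun, (sameJet_taylorFun_prolongFun hfx).fderiv_eq hn]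
      exact h.1 x hx
  obtain ⟨hint, heq⟩ :=
    h.integrableOn_iff_and_setIntegral_eq hn hΩ hf (fun x hx => (hinv x hx).2) L
  exact ⟨hint.trans (integrableOn_congr_fun (fun x hx => (hinv x hx).1) hΩ.measurableSet),
    heq.trans (setIntegral_congr_fun hΩ.measurableSet fun x hx => (hinv x hx).1)⟩

end ChangeOfVariables

section SmallBalls

variable {f : IndepVar p → DepVar q} {x : IndepVar p}

variable (A) in
theorem eventually_det_totalJacobian_pos (hM : IsOpen M) (hf : ContDiff ℝ ∞ f)
    (hx : (x, f x) ∈ M) : ∀ᶠ b in 𝓝 ((1 : G), x),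
      0 < (totalJacobian (A.act b.1) (b.2, f b.2) (fderiv ℝ f b.2)).det := by
  have hcoord : ∀ᶠ b in 𝓝 (coordOne (Coord d) G, x),
      0 < (totalJacobian (A.coordAct b.1) (b.2, f b.2) (fderiv ℝ f b.2)).det := by
    have hfderiv : Continuous (fderiv ℝ f) := hf.continuous_fderiv (by simp)
    have hjet : Continuous fun b : Coord d × IndepVar p => (b.1, (b.2, f b.2), fderiv ℝ f b.2) := by
      fun_prop
    have hcont : ContinuousAt (fun b : Coord d × IndepVar p =>
        totalJacobian (A.coordAct b.1) (b.2, f b.2) (fderiv ℝ f b.2)) (coordOne (Coord d) G, x) :=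
      ContinuousAt.comp (x := (coordOne (Coord d) G, x))
        (g := fun w : Coord d × TotalSpace p q × (IndepVar p →L[ℝ] DepVar q) =>
          totalJacobian (A.coordAct w.1) w.2.1 w.2.2)
        (contDiffAt_totalJacobian (A.contDiffAt_coordAct (A.coordOne_mem_coordDomain hx))
          _).continuousAt hjet.continuousAt
    refine Filter.Tendsto.eventually_const_lt (v :=
      (totalJacobian (A.coordAct (coordOne (Coord d) G)) (x, f x) (fderiv ℝ f x)).det) ?_
      (ContinuousLinearMap.continuous_det.continuousAt.comp hcont)
    rw [coordAct_coordOne, ← jetJacobian_prolongFun le_rfl _ (hf.contDiffAt.of_le (by simp)),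
      A.jetJacobian_act_one hM (by simpa [jetSet, base_prolongFun] using hx)]
    simp [ContinuousLinearMap.det]
  have hchart : ContinuousAt (fun b : G × IndepVar p => (chartOne (Coord d) G b.1, b.2)) (1, x) :=
    (ContinuousAt.comp (f := Prod.fst) (chartOne (Coord d) G |>.continuousAt (mem_chart_source _ _))
      continuousAt_fst).prodMk continuousAt_snd
  have hsource : ∀ᶠ b : G × IndepVar p in 𝓝 (1, x), b.1 ∈ (chartOne (Coord d) G).source :=
    continuousAt_fst.eventually (chart_source_mem_nhds _ _)
  filter_upwards [hsource, hchart.eventually hcoord] with b hb hdet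
  simpa only [A.coordAct_chartOne hb] using hdet

variable (A) in
theorem eventually_mem_prolongedDomain (hM : IsOpen M) (hf : ContDiff ℝ ∞ f) (hx : (x, f x) ∈ M) :
    ∀ᶠ b in 𝓝 ((1 : G), x), b.1 ∈ A.prolongedDomain (b.2, f b.2) (fderiv ℝ f b.2) := by
  have : LocallyConnectedSpace G := ChartedSpace.locallyConnectedSpace (Coord d) G
  have hf' := hf.continuous
  have hc : ContinuousAt (fun b : G × IndepVar p => (b.1, (b.2, f b.2))) (1, x) := by fun_prop
  exact eventually_mem_connectedComponentIn (S := fun y => {g : G | (g, (y, f y)) ∈ A.domain ∧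
    (totalJacobian (A.act g) (y, f y) (fderiv ℝ f y)).det ≠ 0})
    ((hc.eventually (A.isOpen_domain.mem_nhds (A.one_mem _ hx))).and
      ((A.eventually_det_totalJacobian_pos hM hf hx).mono fun _ => ne_of_gt))

theorem exists_isTransform {O : Set (IndepVar p)} (hO : IsOpen O) (hf : ContDiff ℝ ∞ f)
    (hx : x ∈ O) (hg : ∀ y ∈ O, g ∈ A.prolongedDomain (y, f y) (fderiv ℝ f y)) :
    ∃ s ⊆ O, IsOpen s ∧ x ∈ s ∧ ∃ f', ∀ Ω ⊆ s, IsOpen Ω →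
      A.IsTransform g Ω f (baseMap (A.act g) f '' Ω) f' := by
  have ht (y : IndepVar p) (hy : y ∈ O) : IsTransformableAt (A.act g) f y :=
    have h := connectedComponentIn_subset _ _ (hg y hy)
    ⟨A.contDiffAt_act h.1, hf.contDiffAt, h.2⟩
  obtain ⟨e, hxe, heO, heq, hsymm⟩ := exists_openPartialHomeomorph_contDiffOn_symm (m := ∞)
    (by simp) hO (fun y hy => (ht y hy).contDiffAt_baseMap.contDiffWithinAt) hx
    (ht x hx).isInvertible_fderiv_baseMap
  let f' (y : IndepVar p) : DepVar q := (A.act g (e.symm y, f (e.symm y))).2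
  refine ⟨e.source, heO, e.open_source, hxe, f', fun Ω hΩe hΩ => ⟨fun y hy => hg y (heO (hΩe hy)),
    heq ▸ e.isOpen_image_of_subset_source hΩ hΩe, ?_, ?_⟩⟩
  · rintro _ ⟨y, hy, rfl⟩
    have hy' := hΩe hy
    have hey : e.symm (baseMap (A.act g) f y) = y := heq ▸ e.left_inv hy'
    have htarget : e.target ∈ 𝓝 (baseMap (A.act g) f y) :=
      e.open_target.mem_nhds (heq ▸ e.map_source hy')
    refine (ContDiffAt.comp (g := fun y => (A.act g (y, f y)).2) _ ?_
      (hsymm.contDiffAt htarget)).contDiffWithinAt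
    rw [hey]
    exact (ht y (heO hy')).contDiffAt_graph.snd
  · rw [graphOn, graphOn, image_image, image_image]
    refine image_congr fun y hy => ?_
    have hey : e.symm (baseMap (A.act g) f y) = y := heq ▸ e.left_inv (hΩe hy)
    simp only [f', hey]
    rfl

theorem IsVariationalSymmetry.locallyInvariant {Ω₀ : Set (IndepVar p)}
    (hA : A.IsVariationalSymmetry Ω₀ L) (hn : 1 ≤ n) (hM : IsOpen M) (hMΩ₀ : M ⊆ Ω₀ ×ˢ univ)
    (hL : ContinuousOn L (jetSet n M)) : A.LocallyInvariant L := by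
  intro z hz
  obtain ⟨x, f, hf, rfl⟩ := exists_eq_prolongFun z
  rw [jetSet, mem_ofPred_eq, base_prolongFun] at hz
  have hev := (A.eventually_mem_prolongedDomain hM hf hz).and
    (A.eventually_det_totalJacobian_pos hM hf hz)
  rw [nhds_prod_eq] at hev
  filter_upwards [hev.curry] with g hg
  obtain ⟨O, hgO, hO, hxO⟩ := eventually_nhds_iff.1 hg
  obtain ⟨s, hsO, hs, hxs, f', hf'⟩ :=
    exists_isTransform hO hf hxO fun y hy => (hgO y hy).1
  have htr := hf' s subset_rfl hs
  refine eq_of_setIntegral_ball_eq (μ := volume)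
    (F := fun y => pullbackLagrangian L (A.act g) (y, prolongFun n f y))
    (H := fun y => L (y, prolongFun n f y)) hs hxs
    (htr.continuousOn_pullbackLagrangian hn hs hf.contDiffOn hL)
    (continuousOn_lagrangian_prolongFun hL hs hf.contDiffOn fun y hy => htr.mem hy) ?_
  obtain ⟨r₀, hr₀, hball⟩ := Metric.nhds_basis_closedBall.mem_iff.1 (hs.mem_nhds hxs)
  filter_upwards [Ioo_mem_nhdsGT hr₀] with r hr
  have hclosed : Metric.closedBall x r ⊆ s :=
    (Metric.closedBall_subset_closedBall hr.2.le).trans hball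
  have hsub : Metric.ball x r ⊆ s := Metric.ball_subset_closedBall.trans hclosed
  have htr' := hf' _ hsub Metric.isOpen_ball
  rw [← (htr'.integrableOn_iff_and_setIntegral_eq hn Metric.isOpen_ball hf.contDiffOn
    (fun y hy => (hgO y (hsO (hsub hy))).2) L).2]
  refine (hA _ f g _ f' Metric.isOpen_ball
    ((convex_ball x r).isConnected (Metric.nonempty_ball.2 hr.1)) ?_ hf.contDiffOn ?_ htr' ?_).2
  · exact (Metric.closure_ball_subset_closedBall.trans hclosed).trans
      fun y hy => (hMΩ₀ (htr.mem hy)).1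
  · exact image_subset_iff.2 fun y hy => htr'.mem hy
  · exact image_subset_iff.2 fun y hy => (hMΩ₀ (A.act_mem _ _ (htr'.mem_domain hy))).1

end SmallBalls

end LocalTransformationGroup

end VarSym

theorem mainTheorem10_general {p q n d : ℕ} (hn : 1 ≤ n)
    {G : Type*} [TopologicalSpace G] [ChartedSpace (EuclideanSpace ℝ (Fin d)) G]
    [Group G] [LieGroup (𝓡 d) ∞ G]
    (Ω₀ : Set (VarSym.IndepVar p))
    (M : Set (VarSym.TotalSpace p q)) (hM : IsOpen M) (hMΩ₀ : M ⊆ Ω₀ ×ˢ univ)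
    (L : VarSym.JetSpace p q n → ℝ) (hL : DifferentiableOn ℝ L (VarSym.jetSet n M))
    (A : VarSym.LocalTransformationGroup d G M) :
    A.IsVariationalSymmetry Ω₀ L ↔
      ∀ v ∈ A.generators, ∀ z ∈ VarSym.jetSet n M,
        fderiv ℝ L z (VarSym.prolongField n M v z) +
          L z * VarSym.totalDiv hn (fun m => (v m).1) z = 0 := by
  rw [← VarSym.LocalTransformationGroup.locallyInvariant_iff hn hM hL]
  exact ⟨fun h => h.locallyInvariant hn hM hMΩ₀ hL.continuousOn,
    fun h => h.isVariationalSymmetry hn hM Ω₀⟩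

theorem mainTheorem10 {p q n d : ℕ} (hn : 1 ≤ n)
    {G : Type*} [TopologicalSpace G] [ChartedSpace (EuclideanSpace ℝ (Fin d)) G]
    [Group G] [LieGroup (𝓡 d) ∞ G]
    (Ω₀ : Set (VarSym.IndepVar p)) (hΩ₀ : IsOpen Ω₀)
    (M : Set (VarSym.TotalSpace p q)) (hM : IsOpen M) (hMΩ₀ : M ⊆ Ω₀ ×ˢ univ)
    (L : VarSym.JetSpace p q n → ℝ) (hL : ContDiffOn ℝ ∞ L (VarSym.jetSet n M))
    (A : VarSym.LocalTransformationGroup d G M) (hA : A.Connected) :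
    A.IsVariationalSymmetry Ω₀ L ↔
      ∀ v ∈ A.generators, ∀ z ∈ VarSym.jetSet n M,
        fderiv ℝ L z (VarSym.prolongField n M v z) +
          L z * VarSym.totalDiv hn (fun m => (v m).1) z = 0 :=
  mainTheorem10_general hn Ω₀ M hM hMΩ₀ L (hL.differentiableOn (by simp)) A
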